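/- **Theorem (approximate differential calculus on the torus).** *Setting.* Let $d\ge 1$ and $\mathcal N\ge 1$ be integers. Let $\mathbb T_d=(\mathbb Z/(2\mathcal N+1))^d$ be the discrete torus; the coordinates of $\mathbf p\in\mathbb T_d$ are the representatives $\mathbf n_{\mathbf p}\in\{-\mathcal N,\dots,\mathcal N\}^d\subset\mathbb Z^d$, and $n_p$ denotes the coordinate of a point $p$ of the discrete circle $\mathcal S^1_D=\mathbb Z/(2\mathcal N+1)$. Let $\Omega=[-\tfrac12,\tfrac12]^{\mathbb T_d}$, identified with the set of $(2\mathcal N+1)$-periodic configurations $\omega=(\omega_{\mathbf n})_{\mathbf n\in\mathbb Z^d}$, $\omega_{\mathbf n}\in[-\tfrac12,\tfrac12]$, with the translations $(\mathfrak t_{\mathbf m}\omega)_{\mathbf n}=\omega_{\mathbf n+\mathbf m}$ and $(\mathfrak r_{\mathbf p}\omega)_{\mathbf q}=\omega_{\mathbf q+\mathbf p}$. Let $\mathbf F$ be a real antisymmetric $d\times d$ matrix with $F_{ij}\in\frac{2}{2\mathcal N+1}\mathbb Z$, and write $\mathbf x\cdot\mathbf F\cdot\mathbf y=\sum_{j,k}x_jF_{jk}y_k$.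 *Algebras.* $C^*(\Omega\times\mathbb T_d,\mathbf F)$ is the $C^*$-algebra of continuous functions $\tilde f:\Omega\times\mathbb T_d\to\mathbb C$ with the product, the $*$-operation and the norm $\|\tilde f\|=\sup_{\omega}\|\tilde\pi_\omega\tilde f\|$ induced by the representations on $\ell^2(\mathbb T_d)$ $$((\tilde\pi_\omega\tilde f)\phi)(\mathbf p)=\sum_{\mathbf q\in\mathbb T_d}\tilde f(\mathfrak r_{\mathbf p}^{-1}\omega,\mathbf q-\mathbf p)\,e^{i\pi(\mathbf n_{\mathbf q}\cdot\mathbf F\cdot\mathbf n_{\mathbf p})}\phi(\mathbf q).$$ $C^*(\Omega\times\mathbb Z^d,\mathbf F)$ is the completion of the algebra of compactly supported continuous functions $f:\Omega\times\mathbb Z^d\to\mathbb C$, with the structure and the norm $\|f\|=\sup_\omega\|\pi_\omega f\|$ induced by the representations on $\ell^2(\mathbb Z^d)$ $$((\pi_\omega f)\phi)(\mathbf n)=\sum_{\mathbf m\in\mathbb Z^d}f(\mathfrak t_{\mathbf n}^{-1}\omega,\mathbf m-\mathbf n)\,e^{i\pi(\mathbf m\cdot\mathbf F\cdot\mathbf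 n)}\phi(\mathbf m).$$ An element $f$ of the latter is regarded as the function $f(\omega,\mathbf n)=\langle\delta_{\mathbf 0},(\pi_\omega f)\delta_{\mathbf n}\rangle$ on $\Omega\times\mathbb Z^d$. Put $(Pf)(\omega,\mathbf p)=f(\omega,\mathbf n_{\mathbf p})$ and $(J\tilde f)(\omega,\mathbf n)=\sum_{\mathbf q}\delta_{\mathbf n,\mathbf n_{\mathbf q}}\tilde f(\omega,\mathbf q)$. For a multi-index $\boldsymbol\alpha=(\alpha_1,\dots,\alpha_d)$ let $\partial_{\boldsymbol\alpha}=\partial_1^{\alpha_1}\cdots\partial_d^{\alpha_d}$ with $(\partial_jf)(\omega,\mathbf n)=i\,n_jf(\omega,\mathbf n)$, and $|\boldsymbol\alpha|=\alpha_1+\dots+\alpha_d$. *Hamiltonian.* For $W\in\mathbb R$ let $\tilde h=Ph$, where $h(\omega,\mathbf n)=\delta_{|\mathbf n|,1}+W\omega_{\mathbf n}\delta_{\mathbf n,\mathbf 0}$ is the nearest-neighbor hopping Hamiltonian. Let $\kappa>0$ and let $\Phi$ be a complex function analytic in a neighborhood of $\{z:\mathrm{dist}(z,\sigma(J\tilde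 h))\le\kappa\}$. Let $\Phi(\tilde h)$ and $\Phi(J\tilde h)$ be given by the functional calculus of the two $C^*$-algebras, respectively, and let $$\bar\Phi=\frac1{2\pi}\int_{\mathcal C_\kappa}|\Phi(z)|\,|dz|,\qquad \mathcal C_\kappa=\{z\in\mathbb C:\mathrm{dist}(z,\sigma(J\tilde h))=\kappa\}.$$ *Approximate derivations.* Let $\mathfrak x:\mathcal S^1_D\to\mathbb R$ satisfy $\mathfrak x(p)=n_p$ if $|n_p|<\mathcal N/\sqrt2$, and $|\mathfrak x(p)|\le|n_p|$ for all $p\in\mathcal S^1_D$. Let $(\tilde\partial_j\tilde f)(\omega,\mathbf p)=i\,\mathfrak x(p_j)\tilde f(\omega,\mathbf p)$, $j=1,\dots,d$, and $\tilde\partial_{\boldsymbol\alpha}=\tilde\partial_1^{\alpha_1}\cdots\tilde\partial_d^{\alpha_d}$. *Claim.* For every $d\ge1$ and $\kappa>0$ there are finite constants $\mathfrak B_2(\xi,\boldsymbol\alpha)$, depending only on $d,\kappa,\xi,\boldsymbol\alpha$, such that for every $0<\xi<\sinh^{-1}(\kappa/2d)$ and every multi-index $\boldsymbol\alpha$, $$\big\|\tilde\partial_{\boldsymbol\alpha}\Phi(\tilde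 h)-P\,\partial_{\boldsymbol\alpha}\Phi(J\tilde h)\big\|\le\mathfrak B_2(\xi,\boldsymbol\alpha)\,\bar\Phi\,\mathcal N^{|\boldsymbol\alpha|+d}\,e^{-\frac{\xi}{\sqrt2}\mathcal N}$$ for all $\mathcal N\ge1$ and all $\mathbf F$, $W$, $\mathfrak x$, $\Phi$ as above. -/

import Mathlib

open scoped ENNReal

namespace NCTorus

noncomputable section

/-! ### The discrete torus and the space of disorder configurations -/

/-- The discrete torus: `d` discrete circles with `2N+1` points each. The rotation taking the
origin to `p` is the translation `q ↦ q + p`. -/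
abbrev Torus (d N : ℕ) : Type := Fin d → ZMod (2 * N + 1)

/-- The coordinates `n_p ∈ {-N, …, N}^d` of a point of the torus. -/
def coord {d N : ℕ} (p : Torus d N) : Fin d → ℤ := fun j => (p j).valMinAbs

/-- The point of the torus below a lattice point (reduction modulo `2N+1`). -/
def wrap {d N : ℕ} (n : Fin d → ℤ) : Torus d N := fun j => (n j : ZMod (2 * N + 1))

/-- Disorder configurations `ω = (ω_p)` with values in `[-1/2, 1/2]`, indexed by the torus.
They are identified with the configurations on `ℤ^d` which are `(2N+1)`-periodic in every
direction, the value at `n ∈ ℤ^d` being `ω (wrap n)`. -/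
abbrev Config (d N : ℕ) : Type := Torus d N → Set.Icc (-1 / 2 : ℝ) (1 / 2)

/-- The action of the rotations on configurations, `(𝔯_p ω)_q = ω_{q + p}`. For a lattice
point `m` the lattice translation `(𝔱_m ω)_n = ω_{n + m}` of the periodic configuration is
`rot (wrap m)`. -/
def rot {d N : ℕ} (p : Torus d N) (ω : Config d N) : Config d N := fun q => ω (q + p)

lemma continuous_rot {d N : ℕ} (p : Torus d N) : Continuous (rot p) :=
  continuous_pi fun q => continuous_apply (q + p)

/-- The magnetic phase `exp (i π (n · F · m))`. -/
def phase {d : ℕ} (F : Matrix (Fin d) (Fin d) ℝ) (n m : Fin d → ℤ) : ℂ :=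
  Complex.exp (Complex.I * Real.pi * ((∑ j, ∑ k, (n j : ℝ) * F j k * (m k : ℝ) : ℝ) : ℂ))

lemma norm_phase {d : ℕ} (F : Matrix (Fin d) (Fin d) ℝ) (n m : Fin d → ℤ) :
    ‖phase F n m‖ = 1 := by
  have h : phase F n m = Complex.exp
      ((Real.pi * (∑ j, ∑ k, (n j : ℝ) * F j k * (m k : ℝ)) : ℝ) * Complex.I) := by
    unfold phase
    congr 1
    push_cast
    ring
  rw [h, Complex.norm_exp_ofReal_mul_I]

/-! ### The algebra over the torus

An element of the algebra is a continuous function on `Config × Torus`, written as a function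
from the torus to the continuous functions of the configuration. -/

/-- The family `ω ↦ π̃_ω f` of operators on `ℓ²(Torus)`,
`((π̃_ω f) φ)(p) = ∑_q f(𝔯_p⁻¹ ω, q - p) exp (i π (n_q · F · n_p)) φ(q)`. Its norm as a
continuous function of `ω` is the supremum over `ω` of the operator norms. -/
def torusRep {d N : ℕ} (F : Matrix (Fin d) (Fin d) ℝ) (f : Torus d N → C(Config d N, ℂ)) :
    C(Config d N, EuclideanSpace ℂ (Torus d N) →L[ℂ] EuclideanSpace ℂ (Torus d N)) where
  toFun ω := Matrix.toEuclideanCLM (n := Torus d N) (𝕜 := ℂ)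
    (Matrix.of fun p q => f (q - p) (rot (-p) ω) * phase F (coord q) (coord p))
  continuous_toFun := by
    have h : Continuous fun M : Matrix (Torus d N) (Torus d N) ℂ =>
        Matrix.toEuclideanCLM (n := Torus d N) (𝕜 := ℂ) M :=
      LinearMap.continuous_of_finiteDimensional
        ((Matrix.toEuclideanCLM (n := Torus d N) (𝕜 := ℂ)).toAlgEquiv.toLinearMap)
    refine h.comp (continuous_pi fun p => continuous_pi fun q => ?_)
    exact ((f (q - p)).continuous.comp (continuous_rot (-p))).mul continuous_const

/-- The C⋆-subalgebra generated by a set `s` in a C⋆-algebra. -/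
def generatedAlg {A : Type*} [CStarAlgebra A] (s : Set A) : StarSubalgebra ℂ A :=
  (StarAlgebra.adjoin ℂ s).topologicalClosure

lemma isClosed_generatedAlg {A : Type*} [CStarAlgebra A] (s : Set A) :
    IsClosed (generatedAlg s : Set A) :=
  StarSubalgebra.isClosed_topologicalClosure _

lemma subset_generatedAlg {A : Type*} [CStarAlgebra A] (s : Set A) {a : A} (ha : a ∈ s) :
    a ∈ generatedAlg s :=
  StarSubalgebra.le_topologicalClosure _ (StarAlgebra.subset_adjoin ℂ _ ha)

/-- The C⋆-algebra structure of a generated C⋆-subalgebra: that of the ambient algebra. -/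
@[reducible]
def generatedCStarAlgebra {A : Type*} [CStarAlgebra A] (s : Set A) :
    CStarAlgebra (generatedAlg s) :=
  haveI := isClosed_generatedAlg s
  StarSubalgebra.cstarAlgebra (generatedAlg s)

/-- Continuous families, over the configurations, of operators on `ℓ²(Torus)`. -/
abbrev TorusOps (d N : ℕ) : Type :=
  C(Config d N, EuclideanSpace ℂ (Torus d N) →L[ℂ] EuclideanSpace ℂ (Torus d N))

instance cstarTorusOps (d N : ℕ) : CStarAlgebra (TorusOps d N) := inferInstance

/-- The C⋆-algebra over the torus, through its faithful representation `π̃`: the C⋆-algebra of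
operator families generated by the families `ω ↦ π̃_ω f`. -/
def TorusAlg (d N : ℕ) (F : Matrix (Fin d) (Fin d) ℝ) : Type :=
  generatedAlg (A := TorusOps d N) (Set.range (torusRep F))

instance cstarTorusAlg (d N : ℕ) (F : Matrix (Fin d) (Fin d) ℝ) : CStarAlgebra (TorusAlg d N F) :=
  generatedCStarAlgebra (A := TorusOps d N) (Set.range (torusRep F))

/-- A function on `Config × Torus` as an element of the C⋆-algebra. -/
def torusElt {d N : ℕ} (F : Matrix (Fin d) (Fin d) ℝ) (f : Torus d N → C(Config d N, ℂ)) :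
    TorusAlg d N F :=
  ⟨torusRep F f, subset_generatedAlg (A := TorusOps d N) _ ⟨f, rfl⟩⟩

/-- An element of the C⋆-algebra as a function on `Config × Torus`: `f(ω, p)` is the matrix
element of `π̃_ω f` between the origin and `p`. -/
def torusKernel {d N : ℕ} {F : Matrix (Fin d) (Fin d) ℝ} (a : TorusAlg d N F) :
    Torus d N → C(Config d N, ℂ) := fun p =>
  { toFun := fun ω => (a.1 ω (EuclideanSpace.single p 1)).ofLp 0
    continuous_toFun := by
      have h : Continuous fun ω => a.1 ω (EuclideanSpace.single p 1) :=
        a.1.continuous.clm_apply continuous_const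
      exact (EuclideanSpace.proj (𝕜 := ℂ) (0 : Torus d N)).continuous.comp h }

/-! ### The periodic algebra over `ℤ^d` -/

/-- The Hilbert space `ℓ²(ℤ^d)`. -/
abbrev L2 (d : ℕ) : Type := lp (fun _ : Fin d → ℤ => ℂ) 2

lemma weightedShift_memℓp {d : ℕ} (w : (Fin d → ℤ) → ℂ) (C : ℝ) (hw : ∀ n, ‖w n‖ ≤ C)
    (k : Fin d → ℤ) (φ : L2 d) : Memℓp (fun n => w n * φ (n + k)) 2 := by
  have hφ : Summable fun n => ‖φ (n + k)‖ ^ (2 : ℝ≥0∞).toReal :=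
    (Equiv.addRight k).summable_iff.mpr ((lp.memℓp φ).summable (by norm_num))
  refine memℓp_gen (Summable.of_nonneg_of_le (fun n => by positivity) (fun n => ?_)
    (hφ.mul_left (C ^ (2 : ℝ≥0∞).toReal)))
  have hC : 0 ≤ C := (norm_nonneg _).trans (hw n)
  rw [norm_mul, Real.mul_rpow (norm_nonneg _) (norm_nonneg _)]
  gcongr
  exact hw n

/-- The weighted shift `(T φ)(n) = w(n) φ(n + k)` on `ℓ²(ℤ^d)`, for a weight bounded by `C`. -/
def weightedShift {d : ℕ} (w : (Fin d → ℤ) → ℂ) (C : ℝ) (hw : ∀ n, ‖w n‖ ≤ C)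
    (k : Fin d → ℤ) : L2 d →L[ℂ] L2 d :=
  LinearMap.mkContinuous
    { toFun := fun φ => ⟨fun n => w n * φ (n + k), weightedShift_memℓp w C hw k φ⟩
      map_add' := fun φ ψ => by
        ext n
        exact mul_add _ _ _
      map_smul' := fun c φ => by
        ext n
        exact mul_left_comm _ _ _ }
    C
    (fun φ => by
      have hC : 0 ≤ C := (norm_nonneg _).trans (hw 0)
      have h2 : 0 < (2 : ℝ≥0∞).toReal := by norm_num
      have hs : Summable fun n => ‖φ (n + k)‖ ^ (2 : ℝ≥0∞).toReal :=
        (Equiv.addRight k).summable_iff.mpr ((lp.memℓp φ).summable h2)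
      refine lp.norm_le_of_tsum_le h2 (by positivity) ?_
      have hφ : ∑' n, ‖φ (n + k)‖ ^ (2 : ℝ≥0∞).toReal = ‖φ‖ ^ (2 : ℝ≥0∞).toReal := by
        rw [lp.norm_rpow_eq_tsum h2 φ]
        exact (Equiv.addRight k).tsum_eq fun n => ‖φ n‖ ^ (2 : ℝ≥0∞).toReal
      rw [Real.mul_rpow hC (norm_nonneg _), ← hφ, ← tsum_mul_left]
      have hle : ∀ n, ‖w n * φ (n + k)‖ ^ (2 : ℝ≥0∞).toReal
          ≤ C ^ (2 : ℝ≥0∞).toReal * ‖φ (n + k)‖ ^ (2 : ℝ≥0∞).toReal := fun n => by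
        rw [norm_mul, Real.mul_rpow (norm_nonneg _) (norm_nonneg _)]
        gcongr
        exact hw n
      exact Summable.tsum_le_tsum hle
        (Summable.of_nonneg_of_le (fun n => by positivity) hle (hs.mul_left _))
        (hs.mul_left _))

lemma weightedShift_apply {d : ℕ} (w : (Fin d → ℤ) → ℂ) (C : ℝ) (hw : ∀ n, ‖w n‖ ≤ C)
    (k : Fin d → ℤ) (φ : L2 d) (n : Fin d → ℤ) :
    weightedShift w C hw k φ n = w n * φ (n + k) := rfl

lemma norm_weightedShift_sub_le {d : ℕ} (w w' : (Fin d → ℤ) → ℂ) (C C' : ℝ)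
    (hw : ∀ n, ‖w n‖ ≤ C) (hw' : ∀ n, ‖w' n‖ ≤ C') (k : Fin d → ℤ) (ε : ℝ)
    (hε : ∀ n, ‖w n - w' n‖ ≤ ε) :
    ‖weightedShift w C hw k - weightedShift w' C' hw' k‖ ≤ ε := by
  have h : weightedShift w C hw k - weightedShift w' C' hw' k
      = weightedShift (fun n => w n - w' n) ε hε k := by
    ext φ n
    exact (sub_mul _ _ _).symm
  rw [h]
  exact LinearMap.mkContinuous_norm_le _ ((norm_nonneg _).trans (hε 0)) _

/-- The weights `n ↦ g(𝔱_n⁻¹ ω) exp (i π ((n + k) · F · n))`. -/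
def perWeight {d N : ℕ} (F : Matrix (Fin d) (Fin d) ℝ) (k : Fin d → ℤ) (g : C(Config d N, ℂ))
    (ω : Config d N) (n : Fin d → ℤ) : ℂ :=
  g (rot (-wrap n) ω) * phase F (n + k) n

lemma norm_perWeight_le {d N : ℕ} (F : Matrix (Fin d) (Fin d) ℝ) (k : Fin d → ℤ)
    (g : C(Config d N, ℂ)) (ω : Config d N) (n : Fin d → ℤ) : ‖perWeight F k g ω n‖ ≤ ‖g‖ := by
  rw [perWeight, norm_mul, norm_phase, mul_one]
  exact g.norm_coe_le_norm _

/-- The family `ω ↦ π_ω f` when `f` is supported at the single lattice point `k`, with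
`f(ω, k) = g(ω)`. -/
def perRepSingle {d N : ℕ} (F : Matrix (Fin d) (Fin d) ℝ) (k : Fin d → ℤ)
    (g : C(Config d N, ℂ)) : C(Config d N, L2 d →L[ℂ] L2 d) where
  toFun ω := weightedShift (perWeight F k g ω) ‖g‖ (norm_perWeight_le F k g ω) k
  continuous_toFun := by
    rw [continuous_iff_continuousAt]
    intro ω₀
    rw [ContinuousAt, Metric.tendsto_nhds]
    intro ε hε
    have h : ∀ᶠ ω in nhds ω₀, ∀ p : Torus d N, dist (g (rot p ω)) (g (rot p ω₀)) < ε / 2 := by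
      rw [Filter.eventually_all]
      intro p
      exact Metric.tendsto_nhds.mp
        (g.continuous.comp (continuous_rot p)).continuousAt (ε / 2) (by positivity)
    filter_upwards [h] with ω hω
    rw [dist_eq_norm]
    refine (norm_weightedShift_sub_le _ _ _ _ _ _ k (ε / 2) fun n => ?_).trans_lt (by linarith)
    rw [perWeight, perWeight, ← sub_mul, norm_mul, norm_phase, mul_one, ← dist_eq_norm]
    exact (hω _).le

/-- The family `ω ↦ π_ω f` of operators on `ℓ²(ℤ^d)`, for a continuous function `f` with compact
support on `Config × ℤ^d`:
`((π_ω f) φ)(n) = ∑_m f(𝔱_n⁻¹ ω, m - n) exp (i π (m · F · n)) φ(m)`. Its norm as a continuous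
function of `ω` is the supremum over `ω` of the operator norms. -/
def perRep {d N : ℕ} (F : Matrix (Fin d) (Fin d) ℝ) (f : (Fin d → ℤ) →₀ C(Config d N, ℂ)) :
    C(Config d N, L2 d →L[ℂ] L2 d) :=
  f.sum fun k g => perRepSingle F k g

/-- Continuous families, over the configurations, of operators on `ℓ²(ℤ^d)`. -/
abbrev PerOps (d N : ℕ) : Type := C(Config d N, L2 d →L[ℂ] L2 d)

instance cstarPerOps (d N : ℕ) : CStarAlgebra (PerOps d N) := inferInstance

/-- The periodic C⋆-algebra, through its faithful representation `π`: the C⋆-algebra of operator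
families generated by the families `ω ↦ π_ω f`, that is, the completion of the algebra of the
continuous functions with compact support. -/
def PerAlg (d N : ℕ) (F : Matrix (Fin d) (Fin d) ℝ) : Type :=
  generatedAlg (A := PerOps d N) (Set.range (perRep F))

instance cstarPerAlg (d N : ℕ) (F : Matrix (Fin d) (Fin d) ℝ) : CStarAlgebra (PerAlg d N F) :=
  generatedCStarAlgebra (A := PerOps d N) (Set.range (perRep F))

/-- A continuous function with compact support on `Config × ℤ^d` as an element of the
C⋆-algebra. -/
def perElt {d N : ℕ} (F : Matrix (Fin d) (Fin d) ℝ) (f : (Fin d → ℤ) →₀ C(Config d N, ℂ)) :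
    PerAlg d N F :=
  ⟨perRep F f, subset_generatedAlg (A := PerOps d N) _ ⟨f, rfl⟩⟩

/-- An element of the C⋆-algebra as a function on `Config × ℤ^d`: `f(ω, n)` is the matrix
element of `π_ω f` between the origin and `n`. -/
def perKernel {d N : ℕ} {F : Matrix (Fin d) (Fin d) ℝ} (a : PerAlg d N F) :
    (Fin d → ℤ) → C(Config d N, ℂ) := fun n =>
  { toFun := fun ω => inner ℂ (lp.single 2 (0 : Fin d → ℤ) (1 : ℂ) : L2 d)
      (a.1 ω (lp.single 2 n (1 : ℂ)))
    continuous_toFun :=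
      continuous_const.inner (a.1.continuous.clm_apply continuous_const) }

/-! ### The maps between the algebras, and the derivations -/

/-- The map `P` on functions, `(P f)(ω, p) = f(ω, n_p)`. -/
def mapP {d N : ℕ} (f : (Fin d → ℤ) → C(Config d N, ℂ)) : Torus d N → C(Config d N, ℂ) :=
  fun p => f (coord p)

/-- The map `J` on functions, `(J f)(ω, n) = ∑_q δ_{n, n_q} f(ω, q)`. -/
def mapJ {d N : ℕ} (f : Torus d N → C(Config d N, ℂ)) : (Fin d → ℤ) →₀ C(Config d N, ℂ) :=
  ∑ q, Finsupp.single (coord q) (f q)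

/-- The derivation `∂_α = ∂_1^{α_1} ⋯ ∂_d^{α_d}` on functions on `Config × ℤ^d`, where
`(∂_j f)(ω, n) = i n_j f(ω, n)`. -/
def derivZ {d N : ℕ} (α : Fin d → ℕ) (f : (Fin d → ℤ) → C(Config d N, ℂ)) :
    (Fin d → ℤ) → C(Config d N, ℂ) :=
  fun n => (∏ j, (Complex.I * (n j : ℂ)) ^ α j) • f n

/-- The approximate derivation `∂̃_α = ∂̃_1^{α_1} ⋯ ∂̃_d^{α_d}` on functions on `Config × Torus`,
where `(∂̃_j f)(ω, p) = i 𝔵(p_j) f(ω, p)`. -/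
def derivT {d N : ℕ} (𝔵 : ZMod (2 * N + 1) → ℝ) (α : Fin d → ℕ)
    (f : Torus d N → C(Config d N, ℂ)) : Torus d N → C(Config d N, ℂ) :=
  fun p => (∏ j, (Complex.I * (𝔵 (p j) : ℂ)) ^ α j) • f p

/-! ### The Hamiltonians -/

/-- The nearest-neighbor hopping Hamiltonian with disorder strength `W`, for periodic
configurations: `h(ω, n) = δ_{|n|, 1} + W ω_n δ_{n, 0}`. -/
def hamFun {d N : ℕ} (W : ℝ) (n : Fin d → ℤ) : C(Config d N, ℂ) where
  toFun ω := (if ∑ j, n j ^ 2 = 1 then 1 else 0) +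
    (if n = 0 then ((W * (ω (wrap n) : ℝ) : ℝ) : ℂ) else 0)
  continuous_toFun := by
    refine continuous_const.add ?_
    split_ifs
    · exact Complex.continuous_ofReal.comp
        (continuous_const.mul (continuous_subtype_val.comp (continuous_apply _)))
    · exact continuous_const

/-- The Hamiltonian `h̃ = P h` on the torus. -/
def torusHam {d N : ℕ} (F : Matrix (Fin d) (Fin d) ℝ) (W : ℝ) : TorusAlg d N F :=
  torusElt F (mapP (hamFun W))

/-- The Hamiltonian `J h̃` in the periodic algebra. -/
def perHam {d N : ℕ} (F : Matrix (Fin d) (Fin d) ℝ) (W : ℝ) : PerAlg d N F :=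
  perElt F (mapJ (mapP (hamFun W)))

/-! ### The contour `dist(z, S) = κ` -/

/-- For `S ⊆ ℝ` the contour `dist(z, S) = κ` in the complex plane consists of the two graphs
`x ± i √(κ² - dist(x, S)²)` over `dist(x, S) < κ` (up to finitely many points). This is the
upper one. -/
def contourUp (S : Set ℂ) (κ x : ℝ) : ℂ :=
  x + Complex.I * (Real.sqrt (κ ^ 2 - Metric.infDist (x : ℂ) S ^ 2) : ℂ)

/-- The lower graph of the contour `dist(z, S) = κ`. -/
def contourLow (S : Set ℂ) (κ x : ℝ) : ℂ :=
  x - Complex.I * (Real.sqrt (κ ^ 2 - Metric.infDist (x : ℂ) S ^ 2) : ℂ)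

/-- `Φ̄ = (1 / 2π) ∫ |Φ(z)| |dz|` over the contour `dist(z, S) = κ`, for `S ⊆ ℝ`. -/
def contourMean (S : Set ℂ) (κ : ℝ) (Φ : ℂ → ℂ) : ℝ :=
  (2 * Real.pi)⁻¹ * ∫ x in {x : ℝ | Metric.infDist (x : ℂ) S < κ},
    (‖Φ (contourUp S κ x)‖ * ‖deriv (contourUp S κ) x‖ +
      ‖Φ (contourLow S κ x)‖ * ‖deriv (contourLow S κ) x‖)

end

end NCTorus

open NCTorus

/-! Everything reduces to matrix elements of resolvents. Write S for the spectrum of J h̃, a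
nonempty compact subset of the line. On C(S, ℂ), Cauchy's formula writes Φ as an integral of the
functions s ↦ 1/(z - s) over the contour dist(z, S) = κ. Hence any continuous functional bounded by
c on these functions is at most c Φ̄ on Φ (`norm_apply_le_contourMean`). The relevant functionals
are single kernel entries of the functional calculus, on the lattice or on the torus, and
differences of the two.

On the lattice, the Combes–Thomas argument `norm_resolvent_apply_le` gives entries of (z - J h̃)⁻¹
bounded by exp(-ξ |n - m|₁) / (κ - 2d sinh ξ). The potential is diagonal and commutes with the
exponential weights, so W does not enter. The condition ξ < arsinh(κ/2d) is exactly positivity of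
the denominator.

Since F takes values in (2/(2N+1)) ℤ and ω is periodic, the hopping amplitudes descend to the torus.
Summing the lattice resolvent over all translates by (2N+1) ℤ^d therefore inverts z - h̃
(`periodize_mul_sub_eq_one`). This yields σ(h̃) ⊆ σ(J h̃) (`spectrum_torusHam_subset`), so that one
contour serves both operators. It also shows that the two resolvent kernels differ by the translates
other than the central one, which are O(exp(-ξN)); `norm_torusKernel_sub_perKernel_le` carries this
over to Φ.

For the derivatives, the symbols 𝔵(p_j) and n_{p_j} agree unless some coordinate is at least N/√2,
and there the lattice kernel is itself O(exp(-ξN/√2)) (`norm_perKernel_cfc_le`). Both symbols are at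
most N in size, which costs N^|α| (`norm_derivT_sub_derivZ_le`). Passing from entries to the
operator norm costs the number of points of the torus (`norm_torusElt_le`), hence N^d.

As S may be any compact set, for instance with infinitely many gaps, the contour is handled as two
graphs over an open subset of the line that are differentiable off a countable set. Cauchy's theorem
then comes from the fundamental theorem of calculus applied to integrals over vertical segments. -/

namespace NCTorus

open Set Filter Topology Metric MeasureTheory

/-! ### The distance to a compact subset of the line -/

section RealDist

variable {T : Set ℝ}

/-- The midpoints of the gaps of `T`. -/
def gapMidpoints (T : Set ℝ) : Set ℝ :=
  {x | 0 < infDist x T ∧ x - infDist x T ∈ T ∧ x + infDist x T ∈ T}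

lemma infDist_le_abs_sub {x t : ℝ} (ht : t ∈ T) : infDist x T ≤ |x - t| := by
  have := infDist_le_dist_of_mem (x := x) ht
  rwa [Real.dist_eq] at this

/-- The gaps centred at these midpoints are pairwise disjoint nonempty open intervals. Both ends of
a gap lie in `T` and no point of `T` lies inside a gap, so two gaps that meet contain each other. -/
lemma countable_gapMidpoints (T : Set ℝ) : (gapMidpoints T).Countable := by
  have key : ∀ x ∈ gapMidpoints T, ∀ x' ∈ gapMidpoints T,
      x - infDist x T < x' + infDist x' T → x' - infDist x' T < x + infDist x T →
      x - infDist x T ≤ x' - infDist x' T ∧ x' + infDist x' T ≤ x + infDist x T := by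
    intro x hx x' hx' h1 h2
    have ha := infDist_le_abs_sub (x := x') hx.2.1
    have hb := infDist_le_abs_sub (x := x') hx.2.2
    have p := hx.1
    have p' := hx'.1
    rcases le_abs.1 ha with ha | ha <;> rcases le_abs.1 hb with hb | hb <;>
      constructor <;> linarith
  refine Set.PairwiseDisjoint.countable_of_isOpen
    (s := fun x => Ioo (x - infDist x T) (x + infDist x T)) ?_ (fun x _ => isOpen_Ioo)
    (fun x hx => ⟨x, by have := hx.1; constructor <;> linarith⟩)
  intro x hx x' hx' hne
  refine Set.disjoint_left.2 fun u hu hu' => hne ?_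
  have h1 : x - infDist x T < x' + infDist x' T := hu.1.trans hu'.2
  have h2 : x' - infDist x' T < x + infDist x T := hu'.1.trans hu.2
  have k1 := key x hx x' hx' h1 h2
  have k2 := key x' hx' x hx h2 h1
  linarith [k1.1, k1.2, k2.1, k2.2]

lemma exists_nearest (hT : IsCompact T) (hne : T.Nonempty) (x : ℝ) :
    ∃ t ∈ T, infDist x T = |x - t| := by
  obtain ⟨t, ht, h⟩ := hT.exists_infDist_eq_dist hne x
  exact ⟨t, ht, by rw [h, Real.dist_eq]⟩

lemma infDist_eventually_eq_of_left (hT : IsCompact T) (hne : T.Nonempty) {x : ℝ}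
    (h0 : 0 < infDist x T) (hl : x - infDist x T ∈ T) (hr : x + infDist x T ∉ T) :
    ∀ᶠ u in 𝓝 x, infDist u T = u - (x - infDist x T) := by
  set r := infDist x T with hrdef
  obtain ⟨δ, hδ, hball⟩ := Metric.isOpen_iff.1 hT.isClosed.isOpen_compl (x + r) hr
  -- A displacement below `δ / 2` cannot let the points of `T` to the right, at least `r + δ` away
  -- from `x`, overtake the left neighbour. The bound `r` keeps `u` to the right of that neighbour.
  have hmem : Ioo (x - min (δ / 2) r) (x + min (δ / 2) r) ∈ 𝓝 x :=
    Ioo_mem_nhds (by have : 0 < min (δ / 2) r := by positivity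
                     linarith) (by have : 0 < min (δ / 2) r := by positivity
                                   linarith)
  filter_upwards [hmem] with u hu
  have m1 := min_le_left (δ / 2) r
  have m2 := min_le_right (δ / 2) r
  apply le_antisymm
  · refine (infDist_le_abs_sub hl).trans (le_of_eq (abs_of_nonneg ?_))
    linarith [hu.1]
  · obtain ⟨t, ht, hut⟩ := exists_nearest hT hne u
    rw [hut]
    have h1 : r ≤ |x - t| := infDist_le_abs_sub ht
    have h2 : δ ≤ |t - (x + r)| := by
      by_contra hlt
      exact hball (by rw [mem_ball, Real.dist_eq]; exact not_le.1 hlt) ht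
    rcases le_abs.1 h1 with h1 | h1
    · exact le_trans (by linarith) (le_abs_self _)
    · rcases le_abs.1 h2 with h2 | h2
      · rw [abs_sub_comm]
        exact le_trans (by linarith [hu.1, hu.2]) (le_abs_self _)
      · linarith

lemma infDist_eventually_eq_of_right (hT : IsCompact T) (hne : T.Nonempty) {x : ℝ}
    (h0 : 0 < infDist x T) (hr : x + infDist x T ∈ T) (hl : x - infDist x T ∉ T) :
    ∀ᶠ u in 𝓝 x, infDist u T = (x + infDist x T) - u := by
  set r := infDist x T with hrdef
  obtain ⟨δ, hδ, hball⟩ := Metric.isOpen_iff.1 hT.isClosed.isOpen_compl (x - r) hl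
  have hmem : Ioo (x - min (δ / 2) r) (x + min (δ / 2) r) ∈ 𝓝 x :=
    Ioo_mem_nhds (by have : 0 < min (δ / 2) r := by positivity
                     linarith) (by have : 0 < min (δ / 2) r := by positivity
                                   linarith)
  filter_upwards [hmem] with u hu
  have m1 := min_le_left (δ / 2) r
  have m2 := min_le_right (δ / 2) r
  apply le_antisymm
  · refine (infDist_le_abs_sub hr).trans (le_of_eq ?_)
    rw [abs_sub_comm, abs_of_nonneg]
    linarith [hu.2]
  · obtain ⟨t, ht, hut⟩ := exists_nearest hT hne u
    rw [hut]
    have h1 : r ≤ |x - t| := infDist_le_abs_sub ht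
    have h2 : δ ≤ |t - (x - r)| := by
      by_contra hlt
      exact hball (by rw [mem_ball, Real.dist_eq]; exact not_le.1 hlt) ht
    rcases le_abs.1 h1 with h1 | h1
    · rcases le_abs.1 h2 with h2 | h2
      · linarith
      · exact le_trans (by linarith [hu.1, hu.2]) (le_abs_self _)
    · rw [abs_sub_comm]
      exact le_trans (by linarith) (le_abs_self _)

/-- Squaring removes the kinks of the distance at points of `T`. The only remaining corners are the
points with a nearest neighbour on each side, the gap midpoints. -/
lemma exists_hasDerivAt_infDist_sq (hT : IsCompact T) (hne : T.Nonempty) {x : ℝ}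
    (hx : x ∉ gapMidpoints T) :
    ∃ D, HasDerivAt (fun u => infDist u T ^ 2) D x ∧ |D| ≤ 2 * infDist x T := by
  obtain ⟨t, ht, hxt⟩ := exists_nearest hT hne x
  rcases (infDist_nonneg (x := x) (s := T)).eq_or_lt with h0 | h0
  · refine ⟨0, ?_, by simp [← h0]⟩
    have hxt' : t = x := by
      rw [← h0] at hxt
      linarith [abs_eq_zero.1 hxt.symm]
    subst hxt'
    -- At a point `t` of `T` the squared distance lies between `0` and `(u - t) ^ 2`, so its
    -- derivative there is zero.
    rw [hasDerivAt_iff_isLittleO]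
    refine Asymptotics.IsBigO.trans_isLittleO (g := fun u => (u - t) ^ 2) ?_ ?_
    · refine Asymptotics.IsBigO.of_bound 1 (Eventually.of_forall fun u => ?_)
      simp only [← h0, smul_zero, sub_zero, norm_pow, one_mul, ne_eq, OfNat.ofNat_ne_zero,
        not_false_eq_true, zero_pow, Real.norm_eq_abs, abs_of_nonneg infDist_nonneg]
      exact pow_le_pow_left₀ infDist_nonneg (infDist_le_abs_sub ht) 2
    · have h : (fun u : ℝ => u - t) =o[𝓝 t] (fun _ => (1 : ℝ)) := by
        rw [Asymptotics.isLittleO_one_iff]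
        have : Tendsto (fun u : ℝ => u - t) (𝓝 t) (𝓝 (t - t)) :=
          (continuous_id.sub continuous_const).tendsto t
        simpa using this
      have := h.mul_isBigO (Asymptotics.isBigO_refl (fun u : ℝ => u - t) (𝓝 t))
      simpa [pow_two] using this
  · by_cases hl : x - infDist x T ∈ T
    · have hr : x + infDist x T ∉ T := fun hr => hx ⟨h0, hl, hr⟩
      refine ⟨2 * infDist x T, ?_, by rw [abs_of_nonneg (by positivity)]⟩
      have hev := infDist_eventually_eq_of_left hT hne h0 hl hr
      have hd : HasDerivAt (fun u => (u - (x - infDist x T)) ^ 2) (2 * infDist x T) x := by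
        have := ((hasDerivAt_id x).sub_const (x - infDist x T)).fun_pow 2
        simpa using this
      refine hd.congr_of_eventuallyEq ?_
      filter_upwards [hev] with u hu
      rw [hu]
    · have hr : x + infDist x T ∈ T := by
        rcases abs_choice (x - t) with h | h
        · exact absurd (by rw [hxt, h]; simpa using ht) hl
        · rw [hxt, h]; simpa using ht
      refine ⟨-(2 * infDist x T), ?_, by rw [abs_neg, abs_of_nonneg (by positivity)]⟩
      have hev := infDist_eventually_eq_of_right hT hne h0 hr hl
      have hd : HasDerivAt (fun u => ((x + infDist x T) - u) ^ 2) (-(2 * infDist x T)) x := by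
        have := ((hasDerivAt_id x).const_sub (x + infDist x T)).fun_pow 2
        simpa using this
      refine hd.congr_of_eventuallyEq ?_
      filter_upwards [hev] with u hu
      rw [hu]

/-- Away from the set, the distance to it is the distance to one of finitely many points. -/
lemma exists_finset_abs_sub_infDist (hT : IsCompact T) (hne : T.Nonempty) {κ : ℝ} (hκ : 0 < κ) :
    ∃ C : Finset ℝ, ∀ x, κ / 2 ≤ infDist x T → ∃ c ∈ C, |κ - infDist x T| = |x - c| := by
  classical
  -- Two points of `T` in the same closed ball are at most `κ / 4` apart. If `t` is nearest to `x`
  -- at distance at least `κ / 2`, the extreme point of its ball in the direction of `x` has not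
  -- passed `x`, so it would be nearer unless it is `t`. Only the infima and suprema of finitely
  -- many pieces thus occur as `t`, and shifting them by `κ` gives the candidates for `c`.
  obtain ⟨I, hI, hfin, hcov⟩ := hT.finite_cover_balls (e := κ / 8) (by positivity)
  lift I to Finset ℝ using hfin
  have hcpt : ∀ i, IsCompact (T ∩ closedBall i (κ / 8)) := fun i =>
    hT.inter_right isClosed_closedBall
  refine ⟨I.image (fun i => sInf (T ∩ closedBall i (κ / 8)) - κ) ∪
    I.image (fun i => sSup (T ∩ closedBall i (κ / 8)) + κ), fun x hx => ?_⟩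
  obtain ⟨t, ht, hxt⟩ := exists_nearest hT hne x
  obtain ⟨i, hi, hti⟩ := mem_iUnion₂.1 (hcov ht)
  have htm : t ∈ T ∩ closedBall i (κ / 8) := ⟨ht, ball_subset_closedBall hti⟩
  have hclose : ∀ u ∈ T ∩ closedBall i (κ / 8), |u - t| ≤ κ / 4 := by
    intro u hu
    have h1 := hu.2
    have h2 := htm.2
    rw [mem_closedBall, Real.dist_eq, abs_le] at h1 h2
    rw [abs_le]
    constructor <;> linarith [h1.1, h1.2, h2.1, h2.2]
  rw [hxt] at hx ⊢
  rcases abs_choice (x - t) with h | h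
  · have hs := (hcpt i).sSup_mem ⟨t, htm⟩
    have hle : t ≤ sSup (T ∩ closedBall i (κ / 8)) := le_csSup (hcpt i).bddAbove htm
    have hc := hclose _ hs
    have hd := infDist_le_abs_sub (x := x) hs.1
    rw [hxt, h] at hd
    rw [h] at hx ⊢
    rw [abs_le] at hc
    rw [abs_of_nonneg (by linarith [hc.2])] at hd
    have heq : sSup (T ∩ closedBall i (κ / 8)) = t := by linarith
    refine ⟨t + κ, Finset.mem_union_right _ (Finset.mem_image.2 ⟨i, hi, by rw [heq]⟩), ?_⟩
    rw [abs_sub_comm]; congr 1; ring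
  · have hs := (hcpt i).sInf_mem ⟨t, htm⟩
    have hle : sInf (T ∩ closedBall i (κ / 8)) ≤ t := csInf_le (hcpt i).bddBelow htm
    have hc := hclose _ hs
    have hd := infDist_le_abs_sub (x := x) hs.1
    rw [hxt, h] at hd
    rw [h] at hx ⊢
    rw [abs_le] at hc
    rw [abs_sub_comm, abs_of_nonneg (by linarith [hc.1])] at hd
    have heq : sInf (T ∩ closedBall i (κ / 8)) = t := by linarith
    refine ⟨t - κ, Finset.mem_union_left _ (Finset.mem_image.2 ⟨i, hi, by rw [heq]⟩), ?_⟩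
    congr 1; ring

/-- An integrable bound for the slope of the contour. -/
noncomputable def slopeBound (κ : ℝ) (C : Finset ℝ) (x : ℝ) : ℝ :=
  2 + ∑ c ∈ C, Real.sqrt κ * |x - c| ^ (-(1 / 2) : ℝ)

lemma intervalIntegrable_slopeBound (κ : ℝ) (C : Finset ℝ) (a b : ℝ) :
    IntervalIntegrable (slopeBound κ C) MeasureTheory.volume a b := by
  have h0 : ∀ a b : ℝ, IntervalIntegrable (fun x : ℝ => |x| ^ (-(1 / 2) : ℝ))
      MeasureTheory.volume a b := by
    have : ∀ x : ℝ, 0 ≤ x → IntervalIntegrable (fun x : ℝ => |x| ^ (-(1 / 2) : ℝ))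
        MeasureTheory.volume 0 x := by
      intro x hx
      refine (intervalIntegral.intervalIntegrable_rpow' (r := -(1 / 2))
        (by norm_num)).congr ?_
      intro u hu
      rw [uIoc_of_le hx] at hu
      simp only
      rw [abs_of_pos hu.1]
    intro a b
    refine intervalIntegrable_of_even (fun x => by rw [abs_neg]) (fun x hx => this x hx.le)
  refine (intervalIntegrable_const (c := (2 : ℝ))).add ?_
  have : IntervalIntegrable (∑ c ∈ C, fun x : ℝ => Real.sqrt κ * |x - c| ^ (-(1 / 2) : ℝ))
      MeasureTheory.volume a b := by
    refine IntervalIntegrable.sum _ fun c _ => ?_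
    have := (h0 (a - c) (b - c)).comp_sub_right c
    simp only [sub_add_cancel] at this
    exact this.const_mul _
  convert this using 1
  ext x
  simp

/-- The height of the contour above `x`. -/
noncomputable def height (T : Set ℝ) (κ x : ℝ) : ℝ := Real.sqrt (κ ^ 2 - infDist x T ^ 2)

lemma continuous_height (T : Set ℝ) (κ : ℝ) : Continuous (height T κ) :=
  Real.continuous_sqrt.comp (continuous_const.sub ((continuous_infDist_pt T).pow 2))

lemma height_eq_zero {κ x : ℝ} (hκ : 0 < κ) (h : κ ≤ infDist x T) : height T κ x = 0 := by
  rw [height, Real.sqrt_eq_zero']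
  nlinarith

/-- The contour has a slope off a countable set, with an integrable bound. -/
lemma exists_hasDerivAt_height (hT : IsCompact T) (hne : T.Nonempty) {κ : ℝ} (hκ : 0 < κ) :
    ∃ Q : Set ℝ, Q.Countable ∧ ∃ C : Finset ℝ, ∀ x ∉ Q, ∃ D,
      HasDerivAt (height T κ) D x ∧ |D| ≤ slopeBound κ C x ∧ (κ ≤ infDist x T → D = 0) := by
  obtain ⟨C, hC⟩ := exists_finset_abs_sub_infDist hT hne hκ
  have hterm : ∀ x, ∀ c ∈ C, 0 ≤ Real.sqrt κ * |x - c| ^ (-(1 / 2) : ℝ) := fun x c _ => by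
    positivity
  -- The points at distance exactly `κ`, where the square root reaches zero, all belong to `C`.
  refine ⟨gapMidpoints T ∪ C, (countable_gapMidpoints T).union C.countable_toSet, C,
    fun x hx => ?_⟩
  have hxQ : x ∉ gapMidpoints T := fun h => hx (Or.inl h)
  have hxC : x ∉ C := fun h => hx (Or.inr h)
  have hρ : infDist x T ≠ κ := by
    intro h
    obtain ⟨c, hc, he⟩ := hC x (by rw [h]; linarith)
    rw [h, sub_self, abs_zero] at he
    exact hxC (by rwa [sub_eq_zero.1 (abs_eq_zero.1 he.symm)])
  rcases lt_or_gt_of_ne hρ with hlt | hgt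
  · obtain ⟨D, hD, hDle⟩ := exists_hasDerivAt_infDist_sq hT hne hxQ
    have hρ0 : 0 ≤ infDist x T := infDist_nonneg
    have hpos : 0 < κ ^ 2 - infDist x T ^ 2 := by nlinarith
    have hy : 0 < height T κ x := Real.sqrt_pos.2 hpos
    refine ⟨-D / (2 * height T κ x), ?_, ?_, fun h => absurd h (not_le.2 hlt)⟩
    · exact (hD.const_sub (κ ^ 2)).sqrt hpos.ne'
    · have h1 : |-D / (2 * height T κ x)| ≤ infDist x T / height T κ x := by
        rw [abs_div, abs_neg, abs_of_pos (by positivity : 0 < 2 * height T κ x),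
          div_le_div_iff₀ (by positivity) hy]
        nlinarith
      refine h1.trans ?_
      -- With ρ the distance and y the height, the slope is at most ρ / y. If ρ < κ/2, then y ≥ κ/2
      -- keeps it bounded. Otherwise κ² - ρ² ≥ κ(κ - ρ) = κ |x - c|, which leaves an inverse square
      -- root singularity at `c`.
      rcases lt_or_ge (infDist x T) (κ / 2) with hs | hs
      · refine le_trans ?_ (le_add_of_nonneg_right (Finset.sum_nonneg (hterm x)))
        have : κ / 2 ≤ height T κ x := Real.le_sqrt_of_sq_le (by nlinarith)
        rw [div_le_iff₀ hy]
        linarith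
      · obtain ⟨c, hc, he⟩ := hC x hs
        have hb : Real.sqrt κ * |x - c| ^ (-(1 / 2) : ℝ) ≤ slopeBound κ C x :=
          (Finset.single_le_sum (hterm x) hc).trans (le_add_of_nonneg_left zero_le_two)
        refine le_trans ?_ hb
        rw [abs_of_pos (by linarith)] at he
        have hxc : 0 < |x - c| := by rw [← he]; linarith
        have h2 : Real.sqrt κ * Real.sqrt |x - c| ≤ height T κ x := by
          rw [← Real.sqrt_mul hκ.le, ← he]
          exact Real.sqrt_le_sqrt (by nlinarith)
        rw [Real.rpow_neg hxc.le, ← Real.sqrt_eq_rpow, ← div_eq_mul_inv]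
        have hs1 : 0 < Real.sqrt κ := Real.sqrt_pos.2 hκ
        have hs2 : 0 < Real.sqrt |x - c| := Real.sqrt_pos.2 hxc
        calc infDist x T / height T κ x ≤ κ / (Real.sqrt κ * Real.sqrt |x - c|) := by gcongr
          _ = Real.sqrt κ / Real.sqrt |x - c| := by
            rw [div_eq_div_iff (by positivity) (by positivity)]
            nth_rw 1 [← Real.mul_self_sqrt hκ.le]
            ring
  · refine ⟨0, ?_, ?_, fun _ => rfl⟩
    · refine (hasDerivAt_const x (0 : ℝ)).congr_of_eventuallyEq ?_
      filter_upwards [(continuous_infDist_pt T).continuousAt.eventually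
        (lt_mem_nhds hgt)] with u hu
      exact height_eq_zero hκ hu.le
    · rw [abs_zero]
      exact add_nonneg zero_le_two (Finset.sum_nonneg (hterm x))

end RealDist

/-! ### Cauchy's formula on the contour -/

section Contour

variable {S : Set ℂ} {κ : ℝ}

/-- The point of the vertical segment above `x` inside the contour, at relative height `w`. -/
noncomputable def contourPt (S : Set ℂ) (κ w x : ℝ) : ℂ :=
  x + ((w * height (Complex.ofReal ⁻¹' S) κ x : ℝ) : ℂ) * Complex.I

/-- The open set of the line over which the contour lies. -/
def contourBase (S : Set ℂ) (κ : ℝ) : Set ℝ := {x : ℝ | infDist (x : ℂ) S < κ}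

lemma image_ofReal_preimage (hre : ∀ z ∈ S, z.im = 0) :
    Complex.ofReal '' (Complex.ofReal ⁻¹' S) = S := by
  refine image_preimage_eq_of_subset fun z hz => ⟨z.re, ?_⟩
  exact Complex.ext rfl (hre z hz).symm

lemma infDist_ofReal_eq (hre : ∀ z ∈ S, z.im = 0) (x : ℝ) :
    infDist (x : ℂ) S = infDist x (Complex.ofReal ⁻¹' S) := by
  conv_lhs => rw [← image_ofReal_preimage hre]
  exact infDist_image Complex.isometry_ofReal

lemma isCompact_preimage_ofReal (hS : IsCompact S) : IsCompact (Complex.ofReal ⁻¹' S) :=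
  Complex.isometry_ofReal.isClosedEmbedding.isCompact_preimage hS

lemma preimage_ofReal_nonempty (hne : S.Nonempty) (hre : ∀ z ∈ S, z.im = 0) :
    (Complex.ofReal ⁻¹' S).Nonempty := by
  obtain ⟨z, hz⟩ := hne
  refine ⟨z.re, ?_⟩
  have : (z.re : ℂ) = z := Complex.ext rfl (hre z hz).symm
  rwa [mem_preimage, this]

lemma contourUp_eq (hre : ∀ z ∈ S, z.im = 0) : contourUp S κ = contourPt S κ 1 := by
  ext x
  rw [contourUp, contourPt, height, infDist_ofReal_eq hre, one_mul, mul_comm]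

lemma contourLow_eq (hre : ∀ z ∈ S, z.im = 0) : contourLow S κ = contourPt S κ (-1) := by
  ext x
  rw [contourLow, contourPt, height, infDist_ofReal_eq hre]
  push_cast
  ring

lemma continuous_contourPt (w : ℝ) : Continuous (contourPt S κ w) := by
  unfold contourPt
  have := continuous_height (Complex.ofReal ⁻¹' S) κ
  fun_prop

lemma isOpen_contourBase : IsOpen (contourBase S κ) :=
  isOpen_lt ((continuous_infDist_pt S).comp Complex.continuous_ofReal) continuous_const

lemma contourPt_re (w x : ℝ) : (contourPt S κ w x).re = x := by simp [contourPt]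

lemma contourPt_im (w x : ℝ) :
    (contourPt S κ w x).im = w * height (Complex.ofReal ⁻¹' S) κ x := by simp [contourPt]

lemma sq_height {x : ℝ} {T : Set ℝ} (hx : infDist x T ≤ κ) :
    height T κ x ^ 2 = κ ^ 2 - infDist x T ^ 2 :=
  Real.sq_sqrt (by nlinarith [infDist_nonneg (x := x) (s := T)])

lemma dist_ofReal_sq (z : ℂ) (t : ℝ) : dist z t ^ 2 = (z.re - t) ^ 2 + z.im ^ 2 := by
  rw [Complex.dist_eq_re_im, Real.sq_sqrt (by positivity)]
  simp

/-- By Pythagoras with the point `t` of `S` nearest to `x`: (x - t)² + w²(κ² - (x - t)²) ≤ κ². -/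
lemma infDist_contourPt_le (hS : IsCompact S) (hne : S.Nonempty) (hre : ∀ z ∈ S, z.im = 0)
    (hκ : 0 < κ) {w x : ℝ} (hw : |w| ≤ 1) (hx : infDist (x : ℂ) S ≤ κ) :
    infDist (contourPt S κ w x) S ≤ κ := by
  rw [infDist_ofReal_eq hre] at hx
  obtain ⟨t, ht, hxt⟩ := exists_nearest (isCompact_preimage_ofReal hS)
    (preimage_ofReal_nonempty hne hre) x
  refine (infDist_le_dist_of_mem (mem_preimage.1 ht)).trans (abs_le_of_sq_le_sq' ?_ hκ.le).2
  rw [dist_ofReal_sq, contourPt_re, contourPt_im, mul_pow, sq_height hx, hxt, sq_abs]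
  have h1 : w ^ 2 ≤ 1 := by rw [← sq_abs]; nlinarith [abs_nonneg w]
  rw [hxt] at hx
  have h2 : 0 ≤ κ ^ 2 - (x - t) ^ 2 := by rw [← sq_abs (x - t)]; nlinarith [abs_nonneg (x - t)]
  nlinarith

/-- This justifies the parametrization: both graphs lie on the level set. No point of `S` is nearer,
since its real distance to `x` is at least that of the nearest point. -/
lemma infDist_contourPt (hS : IsCompact S) (hne : S.Nonempty) (hre : ∀ z ∈ S, z.im = 0)
    (hκ : 0 < κ) {w x : ℝ} (hw : w ^ 2 = 1) (hx : infDist (x : ℂ) S ≤ κ) :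
    infDist (contourPt S κ w x) S = κ := by
  refine le_antisymm (infDist_contourPt_le hS hne hre hκ ((sq_le_one_iff_abs_le_one w).1 hw.le) hx)
    ((le_infDist hne).2 fun s hs => ?_)
  have hs' : ((s.re : ℝ) : ℂ) = s := Complex.ext rfl (hre s hs).symm
  rw [← hs'] at hs ⊢
  rw [infDist_ofReal_eq hre] at hx
  refine (abs_le_of_sq_le_sq' ?_ dist_nonneg).2
  rw [dist_ofReal_sq, contourPt_re, contourPt_im, mul_pow, sq_height hx, hw]
  have h1 := infDist_le_abs_sub (x := x) (mem_preimage.2 hs)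
  have h2 : infDist x (Complex.ofReal ⁻¹' S) ^ 2 ≤ (x - s.re) ^ 2 := by
    rw [← sq_abs (x - s.re)]
    exact pow_le_pow_left₀ infDist_nonneg h1 2
  linarith

lemma hasDerivAt_contourPt {w x D : ℝ} (h : HasDerivAt (height (Complex.ofReal ⁻¹' S) κ) D x) :
    HasDerivAt (contourPt S κ w) (1 + ((w * D : ℝ) : ℂ) * Complex.I) x :=
  (Complex.ofRealCLM.hasDerivAt (x := x)).add (((h.const_mul w).ofReal_comp).mul_const _)

lemma exists_base_subset_Ioo (hS : IsCompact S) (hne : S.Nonempty) (κ : ℝ) :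
    ∃ R : ℝ, 0 < R ∧ ∀ x : ℝ, infDist (x : ℂ) S ≤ κ → x ∈ Ioo (-R) R := by
  obtain ⟨M, hM⟩ := hS.isBounded.exists_norm_le
  obtain ⟨s, hs⟩ := hne
  have hM0 : 0 ≤ M := (norm_nonneg s).trans (hM s hs)
  refine ⟨M + |κ| + 1, by positivity, fun x hx => ?_⟩
  obtain ⟨t, ht, hxt⟩ := hS.exists_infDist_eq_dist ⟨s, hs⟩ (x : ℂ)
  refine abs_lt.1 ?_
  have h1 : ‖(x : ℂ)‖ ≤ ‖(x : ℂ) - t‖ + ‖t‖ := by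
    simpa using norm_add_le ((x : ℂ) - t) t
  rw [← dist_eq_norm, ← hxt, Complex.norm_real, Real.norm_eq_abs] at h1
  linarith [hM t ht, le_abs_self κ]

/-- The fundamental theorem of calculus for a function whose derivative vanishes off `U`. -/
lemma setIntegral_eq_sub_of_hasDerivAt_indicator {E : Type*} [NormedAddCommGroup E]
    [NormedSpace ℝ E] [CompleteSpace E] {U Q : Set ℝ} (hU : MeasurableSet U) (hQ : Q.Countable)
    {f K : ℝ → E} {R : ℝ} (hR : 0 < R) (hUR : U ⊆ Ioo (-R) R) (hK : Continuous K)
    (hd : ∀ x ∉ Q, HasDerivAt K (U.indicator f x) x) (hf : IntegrableOn f U) :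
    ∫ x in U, f x = K R - K (-R) := by
  have hi : Integrable (U.indicator f) := hf.integrable_indicator hU
  rw [← integral_eq_of_hasDerivAt_off_countable_of_le K (U.indicator f) (by linarith : -R ≤ R) hQ
    hK.continuousOn (fun x hx => hd x hx.2) hi.intervalIntegrable,
    intervalIntegral.integral_of_le (by linarith), setIntegral_indicator hU,
    inter_eq_right.2 (hUR.trans Ioo_subset_Ioc_self)]

/-- The points of the contour form a compact set. -/
lemma isCompact_infDist_eq (hS : IsCompact S) (hne : S.Nonempty) (κ : ℝ) :
    IsCompact {z | infDist z S = κ} := by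
  refine isCompact_of_isClosed_isBounded
    (isClosed_eq (continuous_infDist_pt S) continuous_const) ?_
  refine (hS.isBounded.cthickening (δ := κ)).subset fun z hz => ?_
  obtain ⟨t, ht, hzt⟩ := hS.exists_infDist_eq_dist hne z
  exact mem_cthickening_of_dist_le z t κ S ht (hzt ▸ le_of_eq hz)

/-- The level set is compact, so `h` is bounded on it, and the slope has only integrable
singularities. General values are allowed because the integrand is later a resolvent in C(S, ℂ). -/
lemma integrableOn_deriv_smul_contourPt (hS : IsCompact S) (hne : S.Nonempty)
    (hre : ∀ z ∈ S, z.im = 0) (hκ : 0 < κ) {w : ℝ} (hw : w ^ 2 = 1)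
    {E : Type*} [NormedAddCommGroup E] [NormedSpace ℂ E] {h : ℂ → E}
    (hh : ContinuousOn h {z | infDist z S = κ}) :
    IntegrableOn (fun x => deriv (contourPt S κ w) x • h (contourPt S κ w x))
      (contourBase S κ) := by
  obtain ⟨Q, hQ, C, hD⟩ := exists_hasDerivAt_height (isCompact_preimage_ofReal hS)
    (preimage_ofReal_nonempty hne hre) hκ
  obtain ⟨M, hM⟩ := (isCompact_infDist_eq hS hne κ).exists_bound_of_continuousOn hh
  obtain ⟨R, hR, hUR⟩ := exists_base_subset_Ioo hS hne κ
  have hmaps : ∀ x ∈ contourBase S κ, infDist (contourPt S κ w x) S = κ := fun x hx =>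
    infDist_contourPt hS hne hre hκ hw (le_of_lt hx)
  have hbound : IntegrableOn (fun x => (1 + slopeBound κ C x) * M) (contourBase S κ) := by
    have h1 := ((intervalIntegrable_const (c := (1 : ℝ)) (a := -R) (b := R) (μ := volume)).add
      (intervalIntegrable_slopeBound κ C (-R) R)).mul_const M
    rw [intervalIntegrable_iff_integrableOn_Ioc_of_le (by linarith)] at h1
    exact h1.mono_set fun x hx => Ioo_subset_Ioc_self (hUR x (le_of_lt hx))
  refine hbound.mono' ?_ ?_
  · refine (measurable_deriv _).aestronglyMeasurable.smul ?_
    refine ContinuousOn.aestronglyMeasurable ?_ isOpen_contourBase.measurableSet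
    exact hh.comp (continuous_contourPt w).continuousOn hmaps
  · have h0 : ∀ᵐ x ∂(volume.restrict (contourBase S κ)), x ∉ Q :=
      ae_restrict_of_ae (measure_eq_zero_iff_ae_notMem.1 (hQ.measure_zero volume))
    filter_upwards [h0, ae_restrict_mem isOpen_contourBase.measurableSet] with x hxQ hxU
    obtain ⟨D, hDx, hDle, -⟩ := hD x hxQ
    rw [norm_smul, (hasDerivAt_contourPt hDx).deriv]
    have hw1 : |w| = 1 := by
      rcases sq_eq_one_iff.1 hw with h | h <;> simp [h]
    have hn : ‖1 + ((w * D : ℝ) : ℂ) * Complex.I‖ ≤ 1 + slopeBound κ C x := by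
      refine (norm_add_le _ _).trans ?_
      rw [norm_one, norm_mul, Complex.norm_I, mul_one, Complex.norm_real, Real.norm_eq_abs,
        abs_mul, hw1, one_mul]
      linarith
    exact mul_le_mul hn (hM _ (hmaps x hxU)) (norm_nonneg _) ((norm_nonneg _).trans hn)

/-- Near a point of the base, a function holomorphic inside the contour has a primitive on a
neighborhood of the vertical segment inside the contour. -/
lemma exists_local_primitive (hS : IsCompact S) (hne : S.Nonempty) (hre : ∀ z ∈ S, z.im = 0)
    (hκ : 0 < κ) {O : Set ℂ} (hO : IsOpen O) (hsub : {z | infDist z S ≤ κ} ⊆ O) {g : ℂ → ℂ}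
    (hg : DifferentiableOn ℂ g O) {x₀ : ℝ} (hx₀ : infDist (x₀ : ℂ) S ≤ κ) :
    ∃ G : ℂ → ℂ, ∀ᶠ x in 𝓝 x₀, ∀ w : ℝ, |w| ≤ 1 →
      HasDerivAt G (g (contourPt S κ w x)) (contourPt S κ w x) := by
  set seg := segment ℝ (contourPt S κ (-1) x₀) (contourPt S κ 1 x₀) with hseg
  have hsegO : seg ⊆ O := by
    rintro z ⟨a, b, ha, hb, hab, rfl⟩
    refine hsub (show infDist _ S ≤ κ from ?_)
    have : a • contourPt S κ (-1) x₀ + b • contourPt S κ 1 x₀ = contourPt S κ (b - a) x₀ := by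
      rw [contourPt, contourPt, contourPt, Complex.real_smul, Complex.real_smul,
        show a = 1 - b by linarith]
      push_cast
      ring
    rw [this]
    refine infDist_contourPt_le hS hne hre hκ ?_ hx₀
    rw [abs_le]
    constructor <;> linarith
  have hsegc : IsCompact seg := by
    rw [hseg, segment_eq_image_lineMap]
    exact isCompact_Icc.image AffineMap.lineMap_continuous
  obtain ⟨δ, hδ, hδO⟩ := hsegc.exists_thickening_subset_open hO hsegO
  -- Holomorphic functions have primitives on convex open sets, and a thin neighbourhood of a
  -- segment is convex.
  have hconv : Convex ℝ (thickening δ seg) := (convex_segment _ _).thickening δ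
  obtain ⟨G, hG⟩ := hconv.exists_forall_hasDerivWithinAt (hg.mono hδO)
  refine ⟨G, ?_⟩
  have hmem : ∀ w : ℝ, contourPt S κ w x₀ ∈ seg → ∀ᶠ x in 𝓝 x₀,
      contourPt S κ w x ∈ thickening δ seg := fun w hw =>
    (continuous_contourPt w).continuousAt.eventually
      (isOpen_thickening.mem_nhds (self_subset_thickening hδ _ hw))
  filter_upwards [hmem 1 (right_mem_segment ℝ _ _), hmem (-1) (left_mem_segment ℝ _ _)]
    with x h1 h2 w hw
  have hin : contourPt S κ w x ∈ thickening δ seg := by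
    rw [abs_le] at hw
    -- It suffices that the two ends stay in the neighbourhood: the point at height `w` is their
    -- combination with weights (1 - w)/2 and (1 + w)/2.
    have h := hconv h2 h1 (by linarith : (0 : ℝ) ≤ (1 - w) / 2) (by linarith : 0 ≤ (1 + w) / 2)
      (by ring)
    convert h using 1
    rw [contourPt, contourPt, contourPt, Complex.real_smul, Complex.real_smul]
    push_cast
    ring
  exact (hG _ hin).hasDerivAt (isOpen_thickening.mem_nhds hin)

/-- The integral of `g` over the vertical segment inside the contour. -/
noncomputable def verticalIntegral (S : Set ℂ) (κ : ℝ) (g : ℂ → ℂ) (x : ℝ) : ℂ :=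
  ∫ w in (-1 : ℝ)..1, ((height (Complex.ofReal ⁻¹' S) κ x : ℂ) * Complex.I) *
    g (contourPt S κ w x)

/-- Primitives exist only locally, whereas the vertical integral is defined for every `x`. This
identity glues them and lets the vertical integral be differentiated. -/
lemma verticalIntegral_eq_of_primitive {g G : ℂ → ℂ} {O : Set ℂ} {x : ℝ}
    (hO : ∀ w : ℝ, |w| ≤ 1 → contourPt S κ w x ∈ O) (hg : ContinuousOn g O)
    (hG : ∀ w : ℝ, |w| ≤ 1 → HasDerivAt G (g (contourPt S κ w x)) (contourPt S κ w x)) :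
    verticalIntegral S κ g x = G (contourPt S κ 1 x) - G (contourPt S κ (-1) x) := by
  have hline : ∀ w : ℝ, HasDerivAt (fun w : ℝ => contourPt S κ w x)
      ((height (Complex.ofReal ⁻¹' S) κ x : ℂ) * Complex.I) w := by
    intro w
    have := (((hasDerivAt_id w).mul_const (height (Complex.ofReal ⁻¹' S) κ x)).ofReal_comp.mul_const
      Complex.I).const_add (x : ℂ)
    simpa [contourPt] using this
  have hw : ∀ w ∈ uIcc (-1 : ℝ) 1, |w| ≤ 1 := fun w hw => by
    rw [uIcc_of_le (by norm_num)] at hw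
    exact abs_le.2 hw
  rw [verticalIntegral]
  refine intervalIntegral.integral_eq_sub_of_hasDerivAt (f := fun w => G (contourPt S κ w x))
    (fun w h => ?_) ?_
  · have := (hG w (hw w h)).comp w (hline w)
    rwa [mul_comm] at this
  · refine ContinuousOn.intervalIntegrable (continuousOn_const.mul (hg.comp ?_ ?_))
    · exact fun w _ => (hline w).continuousAt.continuousWithinAt
    · exact fun w h => hO w (hw w h)

/-- Cauchy's theorem: the integral over the contour of a holomorphic function vanishes. -/
lemma integral_contour_eq_zero (hS : IsCompact S) (hne : S.Nonempty) (hre : ∀ z ∈ S, z.im = 0)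
    (hκ : 0 < κ) {O : Set ℂ} (hO : IsOpen O) (hsub : {z | infDist z S ≤ κ} ⊆ O) {g : ℂ → ℂ}
    (hg : DifferentiableOn ℂ g O) :
    ∫ x in contourBase S κ, (deriv (contourPt S κ 1) x * g (contourPt S κ 1 x) -
      deriv (contourPt S κ (-1)) x * g (contourPt S κ (-1) x)) = 0 := by
  obtain ⟨Q, hQ, C, hD⟩ := exists_hasDerivAt_height (isCompact_preimage_ofReal hS)
    (preimage_ofReal_nonempty hne hre) hκ
  obtain ⟨R, hR, hUR⟩ := exists_base_subset_Ioo hS hne κ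
  have hmemO : ∀ x : ℝ, infDist (x : ℂ) S ≤ κ → ∀ w : ℝ, |w| ≤ 1 → contourPt S κ w x ∈ O :=
    fun x hx w hw => hsub (infDist_contourPt_le hS hne hre hκ hw hx)
  have hzero : ∀ x : ℝ, κ ≤ infDist (x : ℂ) S → verticalIntegral S κ g x = 0 := by
    intro x hx
    rw [infDist_ofReal_eq hre] at hx
    simp [verticalIntegral, height_eq_zero hκ hx]
  have hzero' : ∀ x : ℝ, κ < infDist (x : ℂ) S → verticalIntegral S κ g =ᶠ[𝓝 x] fun _ => 0 := by
    intro x hx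
    filter_upwards [((continuous_infDist_pt S).comp Complex.continuous_ofReal).continuousAt.eventually
      (lt_mem_nhds hx)] with u hu
    exact hzero u (le_of_lt hu)
  have hpt : ∀ x : ℝ, κ ≤ infDist (x : ℂ) S → ∀ w, contourPt S κ w x = x := by
    intro x hx w
    rw [infDist_ofReal_eq hre] at hx
    simp [contourPt, height_eq_zero hκ hx]
  have hlocal : ∀ x₀ : ℝ, infDist (x₀ : ℂ) S ≤ κ → ∃ G : ℂ → ℂ,
      (∀ w : ℝ, |w| ≤ 1 → HasDerivAt G (g (contourPt S κ w x₀)) (contourPt S κ w x₀)) ∧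
      verticalIntegral S κ g =ᶠ[𝓝 x₀]
        fun x => G (contourPt S κ 1 x) - G (contourPt S κ (-1) x) := by
    intro x₀ hx₀
    obtain ⟨G, hG⟩ := exists_local_primitive hS hne hre hκ hO hsub hg hx₀
    refine ⟨G, hG.self_of_nhds, ?_⟩
    filter_upwards [hG] with x hx
    -- The neighbourhood may cross an end of the base; beyond it the segment collapses to a point
    -- and both sides vanish.
    rcases le_total (infDist (x : ℂ) S) κ with h | h
    · exact verticalIntegral_eq_of_primitive (hmemO x h) hg.continuousOn hx
    · rw [hzero x h, hpt x h, hpt x h, sub_self]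
  have hcont : Continuous (verticalIntegral S κ g) := by
    rw [continuous_iff_continuousAt]
    intro x
    rcases le_or_gt (infDist (x : ℂ) S) κ with h | h
    · obtain ⟨G, hG, hev⟩ := hlocal x h
      refine ContinuousAt.congr ?_ hev.symm
      exact ((hG 1 (by simp)).continuousAt.comp (continuous_contourPt 1).continuousAt).sub
        ((hG (-1) (by simp)).continuousAt.comp (continuous_contourPt (-1)).continuousAt)
    · exact continuousAt_const.congr (hzero' x h).symm
  have hgc : ContinuousOn g {z | infDist z S = κ} :=
    hg.continuousOn.mono fun z hz => hsub (le_of_eq hz)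
  have h1 := integrableOn_deriv_smul_contourPt hS hne hre hκ (w := 1) (by norm_num) hgc
  have h2 := integrableOn_deriv_smul_contourPt hS hne hre hκ (w := -1) (by norm_num) hgc
  simp only [smul_eq_mul] at h1 h2
  refine (setIntegral_eq_sub_of_hasDerivAt_indicator isOpen_contourBase.measurableSet hQ hR
    (fun x hx => hUR x (le_of_lt hx)) hcont (fun x hxQ => ?_) (h1.sub h2)).trans ?_
  rotate_left
  · have hout : ∀ x, x ∉ Ioo (-R) R → verticalIntegral S κ g x = 0 := fun x hx =>
      hzero x (le_of_lt (not_le.1 fun h => hx (hUR x h)))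
    rw [hout R (by simp), hout (-R) (by simp), sub_zero]
  · obtain ⟨D, hDx, -, hD0⟩ := hD x hxQ
    -- The contour integrand is the derivative of the vertical integral, which is continuous and
    -- vanishes at ±R; the contour integral is therefore zero.
    have hder : infDist (x : ℂ) S ≤ κ → HasDerivAt (verticalIntegral S κ g)
        (deriv (contourPt S κ 1) x * g (contourPt S κ 1 x) -
          deriv (contourPt S κ (-1)) x * g (contourPt S κ (-1) x)) x := by
      intro hx
      obtain ⟨G, hG, hev⟩ := hlocal x hx
      refine HasDerivAt.congr_of_eventuallyEq ?_ hev
      have hp : ∀ w, HasDerivAt (contourPt S κ w) (deriv (contourPt S κ w) x) x := fun w =>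
        (hasDerivAt_contourPt hDx).differentiableAt.hasDerivAt
      have a1 := (hG 1 (by simp)).comp x (hp 1)
      have a2 := (hG (-1) (by simp)).comp x (hp (-1))
      rw [mul_comm] at a1 a2
      exact a1.sub a2
    by_cases hU : x ∈ contourBase S κ
    · rw [indicator_of_mem hU]
      exact hder (le_of_lt hU)
    · rw [indicator_of_notMem hU]
      have hge : κ ≤ infDist (x : ℂ) S := not_lt.1 hU
      rcases hge.eq_or_lt with h | h
      · refine (hder h.ge).congr_deriv ?_
        have hDz : D = 0 := hD0 (by rw [← infDist_ofReal_eq hre]; exact hge)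
        rw [(hasDerivAt_contourPt hDx).deriv, (hasDerivAt_contourPt hDx).deriv, hpt x hge,
          hpt x hge, hDz]
        simp
      · exact (hasDerivAt_const x (0 : ℂ)).congr_of_eventuallyEq (hzero' x h)

end Contour

/-! ### Winding number, Cauchy's formula, and the bound of functionals by Φ̄. -/

section Cauchy

variable {S : Set ℂ} {κ : ℝ}

/-- The contour winds once around every point of `S`. -/
lemma integral_contour_inv_sub (hS : IsCompact S) (hne : S.Nonempty) (hre : ∀ z ∈ S, z.im = 0)
    (hκ : 0 < κ) {s : ℂ} (hs : s ∈ S) :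
    ∫ x in contourBase S κ, (deriv (contourPt S κ 1) x * (contourPt S κ 1 x - s)⁻¹ -
      deriv (contourPt S κ (-1)) x * (contourPt S κ (-1) x - s)⁻¹) =
      -(2 * Real.pi * Complex.I) := by
  obtain ⟨Q, hQ, C, hD⟩ := exists_hasDerivAt_height (isCompact_preimage_ofReal hS)
    (preimage_ofReal_nonempty hne hre) hκ
  obtain ⟨R, hR, hUR⟩ := exists_base_subset_Ioo hS hne κ
  obtain ⟨t, rfl⟩ : ∃ t : ℝ, (t : ℂ) = s := ⟨s.re, Complex.ext rfl (hre s hs).symm⟩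
  have htR : t ∈ Ioo (-R) R := hUR t (by rw [infDist_zero_of_mem hs]; exact hκ.le)
  have hpt : ∀ x : ℝ, κ ≤ infDist (x : ℂ) S → ∀ w, contourPt S κ w x = x := by
    intro x hx w
    rw [infDist_ofReal_eq hre] at hx
    simp [contourPt, height_eq_zero hκ hx]
  -- Rotation by -(w i) makes the principal logarithm usable on each whole graph: the real part is
  -- w² times the height, positive at `x = t`, and the imaginary part is nonzero elsewhere.
  have hslit : ∀ w : ℝ, 0 < w * w → ∀ x : ℝ,
      -(w * Complex.I) * (contourPt S κ w x - t) ∈ Complex.slitPlane := by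
    intro w hw x
    rw [Complex.mem_slitPlane_iff]
    have e1 : (-(w * Complex.I) * (contourPt S κ w x - t)).re =
        w * w * height (Complex.ofReal ⁻¹' S) κ x := by
      simp [contourPt]; ring
    have e2 : (-(w * Complex.I) * (contourPt S κ w x - t)).im = -(w * (x - t)) := by
      simp [contourPt]
    rw [e1, e2]
    by_cases hxt : x = t
    · left
      have : height (Complex.ofReal ⁻¹' S) κ x = κ := by
        rw [height, ← infDist_ofReal_eq hre, hxt, infDist_zero_of_mem hs]
        simp [Real.sqrt_sq hκ.le]
      rw [this]
      positivity
    · right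
      have : w ≠ 0 := fun h => by simp [h] at hw
      rw [neg_ne_zero]
      exact mul_ne_zero this (sub_ne_zero.2 hxt)
  set L : ℝ → ℝ → ℂ := fun w x => Complex.log (-(w * Complex.I) * (contourPt S κ w x - t)) with hL
  have hLc : ∀ w : ℝ, 0 < w * w → Continuous (L w) := fun w hw =>
    (continuous_const.mul ((continuous_contourPt w).sub continuous_const)).clog (hslit w hw)
  have hLd : ∀ w : ℝ, 0 < w * w → ∀ x, DifferentiableAt ℝ (contourPt S κ w) x →
      HasDerivAt (L w) (deriv (contourPt S κ w) x * (contourPt S κ w x - t)⁻¹) x := by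
    intro w hw x hx
    have h := (((hx.hasDerivAt).sub_const (t : ℂ)).const_mul (-(w * Complex.I))).clog_real
      (hslit w hw x)
    convert h using 1
    have hw0 : (w : ℂ) ≠ 0 := by
      intro h0
      rw [Complex.ofReal_eq_zero] at h0
      simp [h0] at hw
    have hne0 : contourPt S κ w x - t ≠ 0 := fun h0 => by
      have := Complex.slitPlane_ne_zero (hslit w hw x)
      simp [h0] at this
    field_simp [Complex.I_ne_zero]
  have hinv : ContinuousOn (fun z : ℂ => (z - t)⁻¹) {z | infDist z S = κ} := by
    refine ContinuousOn.inv₀ (by fun_prop) fun z hz h0 => ?_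
    have hzt : z = t := sub_eq_zero.1 h0
    rw [hzt] at hz
    have : infDist (t : ℂ) S = κ := hz
    rw [infDist_zero_of_mem hs] at this
    exact hκ.ne this
  have h1 := integrableOn_deriv_smul_contourPt hS hne hre hκ (w := 1) (by norm_num) hinv
  have h2 := integrableOn_deriv_smul_contourPt hS hne hre hκ (w := -1) (by norm_num) hinv
  simp only [smul_eq_mul] at h1 h2
  have hmain := setIntegral_eq_sub_of_hasDerivAt_indicator (K := fun x => L 1 x - L (-1) x)
    isOpen_contourBase.measurableSet hQ hR
    (fun x hx => hUR x (le_of_lt hx)) ((hLc 1 (by norm_num)).sub (hLc (-1) (by norm_num)))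
    (fun x hxQ => ?_) (h1.sub h2)
  · refine hmain.trans ?_
    have hout : ∀ x, x ∉ Ioo (-R) R → ∀ w, contourPt S κ w x = x := fun x hx w =>
      hpt x (le_of_lt (not_le.1 fun h => hx (hUR x h))) w
    -- Outside the base the two graphs coincide, so the logarithms differ only through the
    -- rotations: by -πi at `R` and +πi at `-R`. The total -2πi is negative because upper minus
    -- lower, taken from left to right, runs clockwise.
    have hpos : ∀ r : ℝ, 0 < r → Complex.log (Complex.I * r) - Complex.log (-Complex.I * r) =
        Real.pi * Complex.I := by
      intro r hr
      rw [mul_comm, mul_comm (-Complex.I), Complex.log_ofReal_mul hr Complex.I_ne_zero,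
        Complex.log_ofReal_mul hr (neg_ne_zero.2 Complex.I_ne_zero), Complex.log_I,
        Complex.log_neg_I]
      ring
    have e1 : L 1 R - L (-1) R = -(Real.pi * Complex.I) := by
      rw [← hpos (R - t) (by linarith [htR.2])]
      simp only [hL, hout R (by simp)]
      push_cast
      rw [neg_sub]
      congr 2 <;> ring
    have e2 : L 1 (-R) - L (-1) (-R) = Real.pi * Complex.I := by
      rw [← hpos (R + t) (by linarith [htR.1])]
      simp only [hL, hout (-R) (by simp)]
      push_cast
      congr 2 <;> ring
    rw [e1, e2]
    ring
  · obtain ⟨D, hDx, -, hD0⟩ := hD x hxQ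
    have hp : ∀ w, DifferentiableAt ℝ (contourPt S κ w) x := fun w =>
      (hasDerivAt_contourPt hDx).differentiableAt
    have hd := (hLd 1 (by norm_num) x (hp 1)).sub (hLd (-1) (by norm_num) x (hp (-1)))
    by_cases hU : x ∈ contourBase S κ
    · rw [indicator_of_mem hU]
      exact hd
    · rw [indicator_of_notMem hU]
      have hge : κ ≤ infDist (x : ℂ) S := not_lt.1 hU
      refine hd.congr_deriv ?_
      have hDz : D = 0 := hD0 (by rw [← infDist_ofReal_eq hre]; exact hge)
      rw [(hasDerivAt_contourPt hDx).deriv, (hasDerivAt_contourPt hDx).deriv, hpt x hge,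
        hpt x hge, hDz]
      simp

/-- Cauchy's integral formula on the contour. -/
lemma integral_contour_mul_inv_sub (hS : IsCompact S) (hne : S.Nonempty)
    (hre : ∀ z ∈ S, z.im = 0) (hκ : 0 < κ) {Φ : ℂ → ℂ}
    (hΦ : AnalyticOnNhd ℂ Φ {z | infDist z S ≤ κ}) {s : ℂ} (hs : s ∈ S) :
    ∫ x in contourBase S κ,
      (deriv (contourPt S κ 1) x * (Φ (contourPt S κ 1 x) * (contourPt S κ 1 x - s)⁻¹) -
      deriv (contourPt S κ (-1)) x * (Φ (contourPt S κ (-1) x) * (contourPt S κ (-1) x - s)⁻¹)) =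
      -(2 * Real.pi * Complex.I) * Φ s := by
  set O : Set ℂ := {z | AnalyticAt ℂ Φ z} with hO
  have hOo : IsOpen O := isOpen_analyticAt ℂ Φ
  have hsub : {z | infDist z S ≤ κ} ⊆ O := fun z hz => hΦ z hz
  have hsO : s ∈ O := hsub (show infDist s S ≤ κ by rw [infDist_zero_of_mem hs]; exact hκ.le)
  have hΦd : DifferentiableOn ℂ Φ O := fun z hz => hz.differentiableAt.differentiableWithinAt
  have hg : DifferentiableOn ℂ (dslope Φ s) O :=
    (Complex.differentiableOn_dslope (hOo.mem_nhds hsO)).2 hΦd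
  have h0 := integral_contour_eq_zero hS hne hre hκ hOo hsub hg
  have hw := integral_contour_inv_sub hS hne hre hκ hs
  have hinv : ContinuousOn (fun z : ℂ => (z - s)⁻¹) {z | infDist z S = κ} := by
    refine ContinuousOn.inv₀ (by fun_prop) fun z hz h0 => ?_
    have hzt : z = s := sub_eq_zero.1 h0
    rw [hzt] at hz
    have : infDist s S = κ := hz
    rw [infDist_zero_of_mem hs] at this
    exact hκ.ne this
  have hgc : ContinuousOn (dslope Φ s) {z | infDist z S = κ} :=
    hg.continuousOn.mono fun z hz => hsub (le_of_eq hz)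
  have a1 := integrableOn_deriv_smul_contourPt hS hne hre hκ (w := 1) (by norm_num) hinv
  have a2 := integrableOn_deriv_smul_contourPt hS hne hre hκ (w := -1) (by norm_num) hinv
  have b1 := integrableOn_deriv_smul_contourPt hS hne hre hκ (w := 1) (by norm_num) hgc
  have b2 := integrableOn_deriv_smul_contourPt hS hne hre hκ (w := -1) (by norm_num) hgc
  simp only [smul_eq_mul] at a1 a2 b1 b2
  -- Subtracting Φ(s)/(z - s) from Φ(z)/(z - s) leaves `dslope Φ s`, which is holomorphic across
  -- `s`. Cauchy's theorem kills it, and the remaining term is the winding number.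
  have key : ∀ w : ℝ, w ^ 2 = 1 → ∀ x ∈ contourBase S κ,
      deriv (contourPt S κ w) x * (Φ (contourPt S κ w x) * (contourPt S κ w x - s)⁻¹) =
      deriv (contourPt S κ w) x * dslope Φ s (contourPt S κ w x) +
      Φ s * (deriv (contourPt S κ w) x * (contourPt S κ w x - s)⁻¹) := by
    intro w hw x hx
    have hne' : contourPt S κ w x ≠ s := by
      intro h
      have h1 := infDist_contourPt hS hne hre hκ hw (le_of_lt hx)
      rw [h, infDist_zero_of_mem hs] at h1
      exact hκ.ne h1
    rw [dslope_of_ne _ hne', slope_def_field]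
    have : contourPt S κ w x - s ≠ 0 := sub_ne_zero.2 hne'
    field_simp
    ring
  calc _ = ∫ x in contourBase S κ,
      ((deriv (contourPt S κ 1) x * dslope Φ s (contourPt S κ 1 x) -
        deriv (contourPt S κ (-1)) x * dslope Φ s (contourPt S κ (-1) x)) +
      Φ s * (deriv (contourPt S κ 1) x * (contourPt S κ 1 x - s)⁻¹ -
        deriv (contourPt S κ (-1)) x * (contourPt S κ (-1) x - s)⁻¹)) := by
        refine setIntegral_congr_fun isOpen_contourBase.measurableSet fun x hx => ?_
        rw [key 1 (by norm_num) x hx, key (-1) (by norm_num) x hx]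
        ring
    _ = _ := by
        refine (integral_add (b1.sub b2) ((a1.sub a2).const_mul (Φ s))).trans ?_
        rw [integral_const_mul]
        refine (congrArg₂ (fun a b => a + Φ s * b) h0 hw).trans ?_
        ring

/-- The functions `s ↦ (z - s)⁻¹` on `S`, extended by `0` to the `z` where they are not
continuous. -/
noncomputable def resolventFun (S : Set ℂ) (z : ℂ) : C(S, ℂ) :=
  Ring.inverse (algebraMap ℂ C(S, ℂ) z - ⟨Subtype.val, continuous_subtype_val⟩)

lemma isUnit_sub_coe {z : ℂ} (hz : z ∉ S) :
    IsUnit (algebraMap ℂ C(S, ℂ) z - ⟨Subtype.val, continuous_subtype_val⟩) := by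
  rw [ContinuousMap.isUnit_iff_forall_ne_zero]
  intro s h
  have : z - s = 0 := h
  exact hz (by rw [sub_eq_zero.1 this]; exact s.2)

lemma resolventFun_apply {z : ℂ} (hz : z ∉ S) (s : S) :
    resolventFun S z s = (z - (s : ℂ))⁻¹ := by
  have h := congrArg (fun f : C(S, ℂ) => f s) (Ring.mul_inverse_cancel _ (isUnit_sub_coe hz))
  exact eq_inv_of_mul_eq_one_right h

lemma continuousAt_resolventFun [CompactSpace S] {z : ℂ} (hz : z ∉ S) :
    ContinuousAt (resolventFun S) z := by
  have h := NormedRing.inverse_continuousAt (isUnit_sub_coe hz).unit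
  rw [IsUnit.unit_spec] at h
  exact ContinuousAt.comp (f := fun z : ℂ => algebraMap ℂ C(S, ℂ) z -
    ⟨Subtype.val, continuous_subtype_val⟩) h
    (((algebraMapCLM ℂ C(S, ℂ)).continuous.sub continuous_const).continuousAt)

/-- A functional bounded by `c` on the resolvents of the contour is bounded by `c Φ̄` on every
function `Φ` analytic inside the contour. -/
theorem norm_apply_le_contourMean [CompactSpace S] (hne : S.Nonempty)
    (hre : ∀ z ∈ S, z.im = 0) (hκ : 0 < κ) {Φ : ℂ → ℂ}
    (hΦ : AnalyticOnNhd ℂ Φ {z | infDist z S ≤ κ}) (φ : C(S, ℂ)) (hφ : ∀ s : S, φ s = Φ s)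
    (Λ : C(S, ℂ) →L[ℂ] ℂ) (c : ℝ)
    (hc : ∀ z, infDist z S = κ → ‖Λ (resolventFun S z)‖ ≤ c) :
    ‖Λ φ‖ ≤ c * contourMean S κ Φ := by
  have hS : IsCompact S := isCompact_iff_compactSpace.2 inferInstance
  have hΓ : ∀ z, infDist z S = κ → z ∉ S := fun z hz hzS => by
    rw [infDist_zero_of_mem hzS] at hz
    exact hκ.ne hz
  have hΦc : ContinuousOn Φ {z | infDist z S = κ} := fun z hz =>
    (hΦ z (le_of_eq hz)).continuousAt.continuousWithinAt
  have hrc : ContinuousOn (fun z => Φ z • resolventFun S z) {z | infDist z S = κ} :=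
    hΦc.smul fun z hz => (continuousAt_resolventFun (hΓ z hz)).continuousWithinAt
  have i1 := integrableOn_deriv_smul_contourPt hS hne hre hκ (w := 1) (by norm_num) hrc
  have i2 := integrableOn_deriv_smul_contourPt hS hne hre hκ (w := -1) (by norm_num) hrc
  have j1 := (integrableOn_deriv_smul_contourPt hS hne hre hκ (w := 1) (by norm_num) hΦc).norm
  have j2 := (integrableOn_deriv_smul_contourPt hS hne hre hκ (w := -1) (by norm_num) hΦc).norm
  simp only [norm_smul] at j1 j2
  have hU : MeasurableSet (contourBase S κ) := isOpen_contourBase.measurableSet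
  have hmem : ∀ w : ℝ, w ^ 2 = 1 → ∀ x ∈ contourBase S κ, infDist (contourPt S κ w x) S = κ :=
    fun w hw x hx => infDist_contourPt hS hne hre hκ hw (le_of_lt hx)
  set f : ℝ → C(S, ℂ) := fun x =>
    deriv (contourPt S κ 1) x • Φ (contourPt S κ 1 x) • resolventFun S (contourPt S κ 1 x) -
    deriv (contourPt S κ (-1)) x • Φ (contourPt S κ (-1) x) •
      resolventFun S (contourPt S κ (-1) x) with hf
  have hfi : IntegrableOn f (contourBase S κ) := i1.sub i2
  -- Cauchy's formula becomes a Bochner integral in C(S, ℂ), checked by evaluation at each `s`; a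
  -- continuous functional can then be moved under the integral.
  have hrep : (-(2 * Real.pi * Complex.I) : ℂ) • φ = ∫ x in contourBase S κ, f x := by
    ext s
    rw [ContinuousMap.integral_apply hfi, ContinuousMap.smul_apply, hφ, smul_eq_mul,
      ← integral_contour_mul_inv_sub hS hne hre hκ hΦ s.2]
    refine setIntegral_congr_fun hU fun x hx => ?_
    have e : ∀ w : ℝ, w ^ 2 = 1 → (contourPt S κ w x - s)⁻¹ =
        resolventFun S (contourPt S κ w x) s := fun w hw =>
      (resolventFun_apply (hΓ _ (hmem w hw x hx)) s).symm
    rw [e 1 (by norm_num), e (-1) (by norm_num)]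
    rfl
  have hΛ : (-(2 * Real.pi * Complex.I) : ℂ) * Λ φ = ∫ x in contourBase S κ, Λ (f x) := by
    rw [← smul_eq_mul, ← map_smul, hrep, ContinuousLinearMap.integral_comp_comm _ hfi]
  have hle : ‖∫ x in contourBase S κ, Λ (f x)‖ ≤ ∫ x in contourBase S κ,
      c * (‖Φ (contourPt S κ 1 x)‖ * ‖deriv (contourPt S κ 1) x‖ +
        ‖Φ (contourPt S κ (-1) x)‖ * ‖deriv (contourPt S κ (-1)) x‖) := by
    refine norm_integral_le_of_norm_le ?_ ?_
    · have := (j1.add j2).const_mul c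
      refine this.congr (Eventually.of_forall fun x => ?_)
      simp only [Pi.add_apply, mul_comm]
    · refine (ae_restrict_mem hU).mono fun x hx => ?_
      rw [hf]
      simp only [map_sub, map_smul]
      refine (norm_sub_le _ _).trans ?_
      rw [norm_smul, norm_smul, norm_smul, norm_smul, mul_add]
      have b1 := hc _ (hmem 1 (by norm_num) x hx)
      have b2 := hc _ (hmem (-1) (by norm_num) x hx)
      refine add_le_add ?_ ?_
      · rw [← mul_assoc, mul_comm, mul_comm (‖deriv _ _‖)]
        gcongr
      · rw [← mul_assoc, mul_comm, mul_comm (‖deriv _ _‖)]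
        gcongr
  rw [← hΛ, norm_mul, integral_const_mul] at hle
  have hn : ‖(-(2 * Real.pi * Complex.I) : ℂ)‖ = 2 * Real.pi := by
    simp [abs_of_pos Real.pi_pos]
  rw [hn] at hle
  rw [contourMean, contourUp_eq hre, contourLow_eq hre]
  have hpi := Real.pi_pos
  rw [mul_left_comm, ← div_eq_inv_mul, le_div_iff₀ (by positivity), mul_comm]
  exact hle

end Cauchy

/-! ### Combes–Thomas estimate -/

section CombesThomas

variable {d N : ℕ}

/-- The weights of `π_ω (J f)` on the hops by `coord t`. -/
noncomputable def hopWeight (F : Matrix (Fin d) (Fin d) ℝ) (f : Torus d N → C(Config d N, ℂ))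
    (ω : Config d N) (t : Torus d N) (n : Fin d → ℤ) : ℂ :=
  f t (rot (-wrap n) ω) * phase F (n + coord t) n

lemma perRepSingle_add (F : Matrix (Fin d) (Fin d) ℝ) (k : Fin d → ℤ)
    (g g' : C(Config d N, ℂ)) :
    perRepSingle F k (g + g') = perRepSingle F k g + perRepSingle F k g' := by
  ext ω φ n
  exact (congrArg (· * φ (n + k)) (add_mul _ _ _)).trans (add_mul _ _ _)

lemma perRepSingle_zero (F : Matrix (Fin d) (Fin d) ℝ) (k : Fin d → ℤ) :
    perRepSingle F k (0 : C(Config d N, ℂ)) = 0 := by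
  ext ω φ n
  exact (congrArg (· * φ (n + k)) (zero_mul _)).trans (zero_mul _)

lemma perRep_mapJ (F : Matrix (Fin d) (Fin d) ℝ) (f : Torus d N → C(Config d N, ℂ)) :
    perRep F (mapJ f) = ∑ t, perRepSingle F (coord t) (f t) := by
  rw [perRep, mapJ, ← Finsupp.sum_finsetSum_index (fun k => perRepSingle_zero F k)
    (fun k g g' => perRepSingle_add F k g g')]
  exact Finset.sum_congr rfl fun t _ => Finsupp.sum_single_index (perRepSingle_zero F _)

lemma norm_hopWeight_le (F : Matrix (Fin d) (Fin d) ℝ) (f : Torus d N → C(Config d N, ℂ))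
    (ω : Config d N) (t : Torus d N) (n : Fin d → ℤ) : ‖hopWeight F f ω t n‖ ≤ ‖f t‖ :=
  norm_perWeight_le F (coord t) (f t) ω n

lemma perRep_mapJ_apply (F : Matrix (Fin d) (Fin d) ℝ) (f : Torus d N → C(Config d N, ℂ))
    (ω : Config d N) :
    perRep F (mapJ f) ω = ∑ t, weightedShift (hopWeight F f ω t) ‖f t‖
      (norm_hopWeight_le F f ω t) (coord t) := by
  rw [perRep_mapJ, ContinuousMap.sum_apply]
  rfl

lemma norm_weightedShift_le (w : (Fin d → ℤ) → ℂ) (C : ℝ) (hw : ∀ n, ‖w n‖ ≤ C)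
    (k : Fin d → ℤ) : ‖weightedShift w C hw k‖ ≤ C :=
  LinearMap.mkContinuous_norm_le _ ((norm_nonneg _).trans (hw 0)) _

/-- The canonical basis of `ℓ²(ℤ^d)`. -/
noncomputable def basisVec (m : Fin d → ℤ) : L2 d := lp.single 2 m (1 : ℂ)

lemma basisVec_apply (m n : Fin d → ℤ) : basisVec m n = if n = m then 1 else 0 := by
  rw [basisVec, lp.coeFn_single, Pi.single_apply]

lemma norm_basisVec (m : Fin d → ℤ) : ‖basisVec m‖ = 1 := by
  rw [basisVec, lp.norm_single (by norm_num), norm_one]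

lemma weightedShift_basisVec (w : (Fin d → ℤ) → ℂ) (C : ℝ) (hw : ∀ n, ‖w n‖ ≤ C)
    (k m : Fin d → ℤ) :
    weightedShift w C hw k (basisVec m) = w (m - k) • basisVec (m - k) := by
  ext n
  rw [weightedShift_apply, lp.coeFn_smul, Pi.smul_apply, basisVec_apply, basisVec_apply,
    smul_eq_mul]
  by_cases h : n = m - k
  · simp [h]
  · have : n + k ≠ m := fun h' => h (by rw [← h', add_sub_cancel_right])
    simp [h, this]

/-- With `V = T * H * T' - H`, the conjugated resolvent `X` satisfies `X = R * (1 + V * X)`, so κ‖X‖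
≤ 1 + v‖X‖. As `X` already exists with finite norm, this can be solved for ‖X‖ without a Neumann
series. -/
lemma norm_conj_resolvent_le {A : Type*} [NormedRing A] [NormedAlgebra ℂ A] (h1 : ‖(1 : A)‖ ≤ 1)
    {H R T T' : A} {z : ℂ} {κ v : ℝ} (hκ : 0 < κ) (hv : v < κ)
    (hR : R * (algebraMap ℂ A z - H) = 1) (hR' : (algebraMap ℂ A z - H) * R = 1)
    (hRn : ‖R‖ ≤ κ⁻¹) (hT : T' * T = 1) (hT' : T * T' = 1) (hV : ‖T * H * T' - H‖ ≤ v) :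
    ‖T * R * T'‖ ≤ (κ - v)⁻¹ := by
  set X := T * R * T' with hX
  set V := T * H * T' - H with hVdef
  have hc : T * algebraMap ℂ A z * T' = algebraMap ℂ A z := by
    rw [← Algebra.commutes, mul_assoc, hT', mul_one]
  have e1 : (algebraMap ℂ A z - T * H * T') * X = 1 := by
    have : algebraMap ℂ A z - T * H * T' = T * (algebraMap ℂ A z - H) * T' := by
      rw [mul_sub, sub_mul, hc]
    rw [this, hX]
    calc T * (algebraMap ℂ A z - H) * T' * (T * R * T')
        = T * (algebraMap ℂ A z - H) * (T' * T) * R * T' := by noncomm_ring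
      _ = T * ((algebraMap ℂ A z - H) * R) * T' := by rw [hT]; noncomm_ring
      _ = 1 := by rw [hR', mul_one, hT']
  have e2 : (algebraMap ℂ A z - H) * X = 1 + V * X := by
    rw [← e1, hVdef]; noncomm_ring
  have e3 : X = R * (1 + V * X) := by
    rw [← e2, ← mul_assoc, hR, one_mul]
  have hle : ‖X‖ ≤ κ⁻¹ * (1 + v * ‖X‖) := by
    calc ‖X‖ = ‖R * (1 + V * X)‖ := by rw [← e3]
      _ ≤ ‖R‖ * ‖1 + V * X‖ := norm_mul_le _ _
      _ ≤ κ⁻¹ * (1 + v * ‖X‖) := by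
        refine mul_le_mul hRn ?_ (norm_nonneg _) (by positivity)
        refine (norm_add_le _ _).trans (add_le_add h1 ((norm_mul_le _ _).trans ?_))
        gcongr
  rw [← mul_le_mul_iff_of_pos_left hκ, ← mul_assoc, mul_inv_cancel₀ hκ.ne', one_mul] at hle
  rw [← one_div, le_div_iff₀ (by linarith)]
  linarith

/-- The `ℓ¹` norm of a lattice point. -/
def l1 (n : Fin d → ℤ) : ℝ := ∑ j, |(n j : ℝ)|

/-- The bounded weight exponent, linear with slopes `ξ σ_j` near the origin. -/
noncomputable def clampWeight (ξ M : ℝ) (σ : Fin d → ℤ) (n : Fin d → ℤ) : ℝ :=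
  max (-M) (min M (ξ * ∑ j, (σ j : ℝ) * n j))

lemma abs_clampWeight_le {ξ M : ℝ} (hM : 0 ≤ M) (σ n : Fin d → ℤ) :
    |clampWeight ξ M σ n| ≤ M := by
  rw [abs_le]
  exact ⟨le_max_left _ _, max_le (by linarith) (min_le_left _ _)⟩

/-- Clamping makes the weight bounded, so that its exponential is a bounded operator, while
remaining monotone and 1-Lipschitz. Monotonicity matters: it keeps the sign of the change along a
hop, which produces sinh ξ rather than exp ξ - 1 in the threshold. -/
lemma clamp_sub_le {M a b ξ : ℝ} (hab : a ≤ b) (hb : b ≤ a + ξ) :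
    max (-M) (min M a) ≤ max (-M) (min M b) ∧
      max (-M) (min M b) ≤ max (-M) (min M a) + ξ := by
  constructor
  · gcongr
  · have hξ : 0 ≤ ξ := by linarith
    refine max_le (by linarith [le_max_left (-M) (min M a)]) ?_
    have h : min M b ≤ min M a + ξ := by
      rcases le_total M a with h | h
      · rw [min_eq_left h]; exact (min_le_left _ _).trans (by linarith)
      · rw [min_eq_right h]; exact (min_le_right _ _).trans hb
    linarith [le_max_right (-M) (min M a)]

/-- The bound for the relative change of the exponential weight along a hop with `σ · k = u`. -/
noncomputable def hopBound (ξ : ℝ) (u : ℤ) : ℝ :=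
  if 0 ≤ u then 1 - Real.exp (-ξ) else Real.exp ξ - 1

lemma abs_exp_sub_one_le {ξ : ℝ} (hξ : 0 ≤ ξ) {M : ℝ} (σ n k : Fin d → ℤ) {u : ℤ}
    (hu : ∑ j, σ j * k j = u) (hu1 : u = 1 ∨ u = -1) :
    |Real.exp (clampWeight ξ M σ n - clampWeight ξ M σ (n + k)) - 1| ≤ hopBound ξ u := by
  have hsum : ξ * ∑ j, (σ j : ℝ) * ((n + k) j : ℤ) = ξ * ∑ j, (σ j : ℝ) * n j + ξ * u := by
    rw [← hu, ← mul_add]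
    push_cast
    rw [← Finset.sum_add_distrib]
    congr 1
    refine Finset.sum_congr rfl fun j _ => ?_
    simp only [Pi.add_apply, Int.cast_add]
    ring
  rw [clampWeight, clampWeight, hsum, hopBound]
  rcases hu1 with rfl | rfl
  · obtain ⟨h1, h2⟩ := clamp_sub_le (M := M) (a := ξ * ∑ j, (σ j : ℝ) * n j)
      (b := ξ * ∑ j, (σ j : ℝ) * n j + ξ * (1 : ℤ)) (ξ := ξ) (by push_cast; linarith)
      (by push_cast; linarith)
    rw [if_pos (by norm_num), abs_of_nonpos (sub_nonpos.2 (Real.exp_le_one_iff.2 (by linarith)))]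
    have := Real.exp_le_exp.2 (show -ξ ≤ max (-M) (min M (ξ * ∑ j, (σ j : ℝ) * n j)) -
      max (-M) (min M (ξ * ∑ j, (σ j : ℝ) * n j + ξ * (1 : ℤ))) by linarith)
    linarith
  · obtain ⟨h1, h2⟩ := clamp_sub_le (M := M) (a := ξ * ∑ j, (σ j : ℝ) * n j + ξ * (-1 : ℤ))
      (b := ξ * ∑ j, (σ j : ℝ) * n j) (ξ := ξ) (by push_cast; linarith)
      (by push_cast; linarith)
    rw [if_neg (by norm_num), abs_of_nonneg (sub_nonneg.2 (Real.one_le_exp (by linarith)))]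
    have := Real.exp_le_exp.2 (show max (-M) (min M (ξ * ∑ j, (σ j : ℝ) * n j)) -
      max (-M) (min M (ξ * ∑ j, (σ j : ℝ) * n j + ξ * (-1 : ℤ))) ≤ ξ by linarith)
    linarith

lemma coord_injective : Function.Injective (coord : Torus d N → Fin d → ℤ) := fun _ _ h =>
  funext fun j => ZMod.injective_valMinAbs (congrFun h j)

lemma exists_eq_single_of_sum_sq_eq_one {n : Fin d → ℤ} (h : ∑ j, n j ^ 2 = 1) :
    ∃ j, ∃ b : Bool, n = Pi.single j (if b then 1 else -1) := by
  have hex : ∃ j, n j ≠ 0 := by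
    by_contra hall
    push Not at hall
    simp [hall] at h
  obtain ⟨j, hj⟩ := hex
  have hsplit := Finset.add_sum_erase Finset.univ (fun i => n i ^ 2) (Finset.mem_univ j)
  have hnn : 0 ≤ ∑ i ∈ Finset.univ.erase j, n i ^ 2 := Finset.sum_nonneg fun i _ => sq_nonneg _
  have hpos : 1 ≤ n j ^ 2 := Int.add_one_le_iff.2 (lt_of_le_of_ne (sq_nonneg _) (pow_ne_zero 2 hj).symm)
  have hz : ∑ i ∈ Finset.univ.erase j, n i ^ 2 = 0 := by linarith
  have hj1 : n j ^ 2 = 1 := by linarith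
  rw [Finset.sum_eq_zero_iff_of_nonneg fun i _ => sq_nonneg _] at hz
  have hoff : ∀ i, i ≠ j → n i = 0 := fun i hi =>
    pow_eq_zero_iff (two_ne_zero) |>.1 (hz i (Finset.mem_erase.2 ⟨hi, Finset.mem_univ _⟩))
  rcases sq_eq_one_iff.1 hj1 with h1 | h1
  · refine ⟨j, true, funext fun i => ?_⟩
    by_cases hi : i = j
    · subst hi; simp [h1]
    · simp [hi, hoff i hi]
  · refine ⟨j, false, funext fun i => ?_⟩
    by_cases hi : i = j
    · subst hi; simp [h1]
    · simp [hi, hoff i hi]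

lemma hopBound_nonneg {ξ : ℝ} (hξ : 0 ≤ ξ) (u : ℤ) : 0 ≤ hopBound ξ u := by
  rw [hopBound]
  split_ifs
  · exact sub_nonneg.2 (Real.exp_le_one_iff.2 (by linarith))
  · exact sub_nonneg.2 (Real.one_le_exp hξ)

/-- The sum of the hop bounds over the nearest neighbors. -/
lemma sum_hopBound_le {ξ : ℝ} (hξ : 0 ≤ ξ) {σ : Fin d → ℤ} (hσ : ∀ j, σ j = 1 ∨ σ j = -1) :
    ∑ t : Torus d N, (if ∑ j, coord t j ^ 2 = 1 then hopBound ξ (∑ j, σ j * coord t j) else 0)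
      ≤ 2 * d * Real.sinh ξ := by
  classical
  calc _ ≤ ∑ t : Torus d N, ∑ j : Fin d, ∑ b : Bool,
        (if coord t = Pi.single j (if b then 1 else -1) then
          hopBound ξ (σ j * (if b then 1 else -1)) else 0) := by
        refine Finset.sum_le_sum fun t _ => ?_
        have hnn : ∀ (j : Fin d) (b : Bool), 0 ≤ (if coord t = Pi.single j (if b then 1 else -1)
            then hopBound ξ (σ j * (if b then 1 else -1)) else 0) := fun j b => by
          split_ifs <;> first | exact hopBound_nonneg hξ _ | exact le_rfl
        split_ifs with h
        · obtain ⟨j, b, hjb⟩ := exists_eq_single_of_sum_sq_eq_one h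
          refine le_trans ?_ (Finset.single_le_sum (fun j _ => Finset.sum_nonneg fun b _ => hnn j b)
            (Finset.mem_univ j))
          refine le_trans ?_ (Finset.single_le_sum (fun b _ => hnn j b) (Finset.mem_univ b))
          rw [if_pos hjb, hjb]
          refine le_of_eq (congrArg _ ?_)
          rw [Finset.sum_eq_single j (fun i _ hi => by rw [Pi.single_eq_of_ne hi, mul_zero])
            (fun h => absurd (Finset.mem_univ j) h), Pi.single_eq_same]
        · exact Finset.sum_nonneg fun j _ => Finset.sum_nonneg fun b _ => hnn j b
    _ = ∑ j : Fin d, ∑ b : Bool, ∑ t : Torus d N,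
        (if coord t = Pi.single j (if b then 1 else -1) then
          hopBound ξ (σ j * (if b then 1 else -1)) else 0) := by
        rw [Finset.sum_comm]
        exact Finset.sum_congr rfl fun _ _ => Finset.sum_comm
    _ ≤ ∑ j : Fin d, ∑ b : Bool, hopBound ξ (σ j * (if b then 1 else -1)) := by
        refine Finset.sum_le_sum fun j _ => Finset.sum_le_sum fun b _ => ?_
        rw [← Finset.sum_filter, Finset.sum_const, nsmul_eq_mul]
        have hcard : (Finset.univ.filter fun t : Torus d N =>
            coord t = Pi.single j (if b then 1 else -1)).card ≤ 1 := by
          refine Finset.card_le_one.2 fun s hs t ht => coord_injective ?_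
          rw [(Finset.mem_filter.1 hs).2, (Finset.mem_filter.1 ht).2]
        have : ((Finset.univ.filter fun t : Torus d N =>
            coord t = Pi.single j (if b then 1 else -1)).card : ℝ) ≤ 1 := by exact_mod_cast hcard
        exact mul_le_of_le_one_left (hopBound_nonneg hξ _) this
    -- The two opposite hops along an axis contribute (1 - exp(-ξ)) + (exp ξ - 1) = 2 sinh ξ,
    -- whichever sign `σ j` has.
    _ = ∑ j : Fin d, 2 * Real.sinh ξ := by
        refine Finset.sum_congr rfl fun j _ => ?_
        rw [Fintype.sum_bool, Real.sinh_eq]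
        rcases hσ j with h | h <;> simp [h, hopBound] <;> ring
    _ = 2 * d * Real.sinh ξ := by
        rw [Finset.sum_const, Finset.card_univ, Fintype.card_fin, nsmul_eq_mul]
        ring

lemma coord_zero : coord (0 : Torus d N) = 0 := funext fun _ => ZMod.valMinAbs_zero _

/-- The multiplication by the exponential of a clamped weight. -/
noncomputable def expMul (ξ M : ℝ) (hM : 0 ≤ M) (σ : Fin d → ℤ) (s : ℤˣ) : L2 d →L[ℂ] L2 d :=
  weightedShift (fun n => (Real.exp ((s : ℤ) * clampWeight ξ M σ n) : ℂ)) (Real.exp M) (fun n => by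
    rw [Complex.norm_real, Real.norm_eq_abs, Real.abs_exp, Real.exp_le_exp]
    refine (le_abs_self _).trans ?_
    rw [abs_mul]
    rcases Int.units_eq_one_or s with rfl | rfl <;>
      simpa using abs_clampWeight_le hM σ n) 0

lemma expMul_apply (ξ M : ℝ) (hM : 0 ≤ M) (σ : Fin d → ℤ) (s : ℤˣ) (φ : L2 d) (n : Fin d → ℤ) :
    expMul ξ M hM σ s φ n = (Real.exp ((s : ℤ) * clampWeight ξ M σ n) : ℂ) * φ n := by
  rw [expMul, weightedShift_apply, add_zero]

lemma expMul_mul_expMul (ξ M : ℝ) (hM : 0 ≤ M) (σ : Fin d → ℤ) (s : ℤˣ) :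
    expMul ξ M hM σ s * expMul ξ M hM σ (-s) = 1 := by
  ext φ n
  rw [mul_apply_eq_comp, expMul_apply, expMul_apply, ← mul_assoc,
    ← Complex.ofReal_mul, ← Real.exp_add]
  simp

/-- Conjugation multiplies each hop by the exponential of a weight difference, so the error is a sum
of weighted shifts, one for each neighbour. The bound depends neither on `M` nor on `W`. -/
lemma norm_conj_sub_le {F : Matrix (Fin d) (Fin d) ℝ} {W : ℝ} {ω : Config d N} {ξ M : ℝ}
    (hξ : 0 ≤ ξ) (hM : 0 ≤ M) {σ : Fin d → ℤ} (hσ : ∀ j, σ j = 1 ∨ σ j = -1) :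
    ‖expMul ξ M hM σ 1 * perRep F (mapJ (mapP (hamFun W))) ω * expMul ξ M hM σ (-1) -
      perRep F (mapJ (mapP (hamFun W))) ω‖ ≤ 2 * d * Real.sinh ξ := by
  set f : Torus d N → C(Config d N, ℂ) := mapP (hamFun W) with hf
  set v : Torus d N → (Fin d → ℤ) → ℂ := fun t n => hopWeight F f ω t n *
    ((Real.exp (clampWeight ξ M σ n - clampWeight ξ M σ (n + coord t)) : ℂ) - 1) with hv
  set b : Torus d N → ℝ := fun t =>
    if ∑ j, coord t j ^ 2 = 1 then hopBound ξ (∑ j, σ j * coord t j) else 0 with hb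
  have hvb : ∀ t n, ‖v t n‖ ≤ b t := by
    intro t n
    simp only [hv, hb, norm_mul]
    have hreal : ‖((Real.exp (clampWeight ξ M σ n - clampWeight ξ M σ (n + coord t)) : ℂ) - 1)‖ =
        |Real.exp (clampWeight ξ M σ n - clampWeight ξ M σ (n + coord t)) - 1| := by
      rw [← Complex.ofReal_one, ← Complex.ofReal_sub, Complex.norm_real, Real.norm_eq_abs]
    rw [hreal]
    split_ifs with h
    · have hne : coord t ≠ 0 := fun h0 => by simp [h0] at h
      have hw : ‖hopWeight F f ω t n‖ ≤ 1 := by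
        rw [hopWeight, norm_mul, norm_phase, mul_one]
        simp [hf, mapP, hamFun, h, hne]
      have hu : ∑ j, σ j * coord t j = 1 ∨ ∑ j, σ j * coord t j = -1 := by
        obtain ⟨j, c, hjc⟩ := exists_eq_single_of_sum_sq_eq_one h
        rw [hjc, Finset.sum_eq_single j
          (fun i _ hi => by rw [Pi.single_eq_of_ne hi, mul_zero])
          (fun h => absurd (Finset.mem_univ j) h), Pi.single_eq_same]
        rcases hσ j with h | h <;> cases c <;> simp [h]
      exact (mul_le_of_le_one_left (abs_nonneg _) hw).trans
        (abs_exp_sub_one_le hξ σ n (coord t) rfl hu)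
    -- The on-site term is diagonal and commutes with the weights, so the disorder drops out.
    · by_cases h0 : coord t = 0
      · rw [h0, add_zero, sub_self, Real.exp_zero, sub_self, abs_zero, mul_zero]
      · have : hopWeight F f ω t n = 0 := by
          simp [hopWeight, hf, mapP, hamFun, h, h0]
        rw [this, norm_zero, zero_mul]
  have heq : expMul ξ M hM σ 1 * perRep F (mapJ f) ω * expMul ξ M hM σ (-1) -
      perRep F (mapJ f) ω = ∑ t, weightedShift (v t) (b t) (hvb t) (coord t) := by
    rw [perRep_mapJ_apply, Finset.mul_sum, Finset.sum_mul, ← Finset.sum_sub_distrib]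
    refine Finset.sum_congr rfl fun t _ => ?_
    ext φ n
    rw [sub_apply, mul_apply_eq_comp,
      mul_apply_eq_comp, lp.coeFn_sub, Pi.sub_apply, expMul_apply,
      weightedShift_apply, weightedShift_apply, weightedShift_apply, expMul_apply]
    simp only [hv]
    rw [sub_eq_add_neg (clampWeight ξ M σ n), Real.exp_add]
    push_cast
    simp only [one_mul, neg_mul]
    ring
  rw [heq]
  refine (norm_sum_le _ _).trans ((Finset.sum_le_sum fun t _ =>
    norm_weightedShift_le _ _ (hvb t) _).trans (sum_hopBound_le hξ hσ))

/-- The Combes–Thomas estimate: exponential decay of the resolvent. -/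
theorem norm_resolvent_apply_le {F : Matrix (Fin d) (Fin d) ℝ} {W : ℝ} {ω : Config d N}
    {ξ κ : ℝ} (hξ : 0 ≤ ξ) (hκ : 0 < κ) (hξκ : 2 * d * Real.sinh ξ < κ) {z : ℂ}
    {R : L2 d →L[ℂ] L2 d}
    (hR : R * (algebraMap ℂ _ z - perRep F (mapJ (mapP (hamFun W))) ω) = 1)
    (hR' : (algebraMap ℂ _ z - perRep F (mapJ (mapP (hamFun W))) ω) * R = 1)
    (hRn : ‖R‖ ≤ κ⁻¹) (n m : Fin d → ℤ) :
    ‖R (basisVec m) n‖ ≤ (κ - 2 * d * Real.sinh ξ)⁻¹ * Real.exp (-ξ * l1 (n - m)) := by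
  -- The cutoff is just large enough for the clamp to be inactive at `n` and `m`. The signs `σ`
  -- below are chosen so that σ·(n - m) = |n - m|₁.
  set M : ℝ := ξ * (l1 n + l1 m) with hMdef
  have hl1 : ∀ k : Fin d → ℤ, 0 ≤ l1 k := fun k => Finset.sum_nonneg fun j _ => abs_nonneg _
  have hM : 0 ≤ M := mul_nonneg hξ (add_nonneg (hl1 n) (hl1 m))
  set σ : Fin d → ℤ := fun j => if m j ≤ n j then 1 else -1 with hσdef
  have hσ : ∀ j, σ j = 1 ∨ σ j = -1 := fun j => by
    simp only [hσdef]; split_ifs <;> simp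
  have hT := expMul_mul_expMul ξ M hM σ 1
  have hT' := expMul_mul_expMul ξ M hM σ (-1)
  rw [neg_neg] at hT'
  have hX := norm_conj_resolvent_le (ContinuousLinearMap.norm_id_le) hκ hξκ hR hR' hRn hT' hT
    (norm_conj_sub_le hξ hM hσ)
  have hclamp : ∀ k : Fin d → ℤ, ξ * l1 k ≤ M →
      clampWeight ξ M σ k = ξ * ∑ j, (σ j : ℝ) * k j := by
    intro k hk
    have habs : |ξ * ∑ j, (σ j : ℝ) * k j| ≤ M := by
      refine le_trans ?_ hk
      rw [abs_mul, abs_of_nonneg hξ]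
      refine mul_le_mul_of_nonneg_left ?_ hξ
      refine (Finset.abs_sum_le_sum_abs _ _).trans (Finset.sum_le_sum fun j _ => ?_)
      rcases hσ j with h | h <;> simp [h]
    rw [abs_le] at habs
    rw [clampWeight, min_eq_right habs.2, max_eq_right habs.1]
  have hn := hclamp n (mul_le_mul_of_nonneg_left (by linarith [hl1 m]) hξ)
  have hm := hclamp m (mul_le_mul_of_nonneg_left (by linarith [hl1 n]) hξ)
  have hdiff : clampWeight ξ M σ n - clampWeight ξ M σ m = ξ * l1 (n - m) := by
    rw [hn, hm, ← mul_sub, ← Finset.sum_sub_distrib, l1]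
    congr 1
    refine Finset.sum_congr rfl fun j _ => ?_
    simp only [hσdef, Pi.sub_apply, Int.cast_sub]
    split_ifs with h
    · rw [abs_of_nonneg (sub_nonneg.2 (by exact_mod_cast h))]
      push_cast; ring
    · rw [abs_of_nonpos (sub_nonpos.2 (by exact_mod_cast (not_le.1 h).le))]
      push_cast; ring
  have hval : (expMul ξ M hM σ 1 * R * expMul ξ M hM σ (-1)) (basisVec m) n =
      (Real.exp (ξ * l1 (n - m)) : ℂ) * R (basisVec m) n := by
    have hbv : expMul ξ M hM σ (-1) (basisVec m) =
        (Real.exp (-clampWeight ξ M σ m) : ℂ) • basisVec m := by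
      rw [expMul, weightedShift_basisVec, sub_zero]
      simp
    rw [mul_apply_eq_comp, mul_apply_eq_comp, expMul_apply, hbv, map_smul,
      lp.coeFn_smul, Pi.smul_apply, smul_eq_mul, ← hdiff, sub_eq_add_neg, Real.exp_add]
    push_cast
    simp only [one_mul]
    ring
  have hle : Real.exp (ξ * l1 (n - m)) * ‖R (basisVec m) n‖ ≤ (κ - 2 * d * Real.sinh ξ)⁻¹ := by
    have h1 := lp.norm_apply_le_norm (two_ne_zero)
      ((expMul ξ M hM σ 1 * R * expMul ξ M hM σ (-1)) (basisVec m)) n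
    rw [hval, norm_mul, Complex.norm_real, Real.norm_eq_abs, Real.abs_exp] at h1
    refine h1.trans ((ContinuousLinearMap.le_opNorm _ _).trans ?_)
    rw [norm_basisVec, mul_one]
    exact hX
  rw [neg_mul, Real.exp_neg, ← div_eq_mul_inv, le_div_iff₀ (Real.exp_pos _), mul_comm]
  exact hle

end CombesThomas

/-! ### Periodization -/

section Periodization

variable {d N : ℕ}

lemma phase_add_left (F : Matrix (Fin d) (Fin d) ℝ) (n n' m : Fin d → ℤ) :
    phase F (n + n') m = phase F n m * phase F n' m := by
  rw [phase, phase, phase, ← Complex.exp_add, ← mul_add, ← Complex.ofReal_add,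
    ← Finset.sum_add_distrib]
  refine congrArg (fun x : ℝ => Complex.exp (Complex.I * Real.pi * (x : ℂ))) ?_
  refine Finset.sum_congr rfl fun j _ => ?_
  rw [← Finset.sum_add_distrib]
  refine Finset.sum_congr rfl fun k _ => ?_
  rw [Pi.add_apply, Int.cast_add]
  ring

lemma phase_add_right (F : Matrix (Fin d) (Fin d) ℝ) (n m m' : Fin d → ℤ) :
    phase F n (m + m') = phase F n m * phase F n m' := by
  rw [phase, phase, phase, ← Complex.exp_add, ← mul_add, ← Complex.ofReal_add,
    ← Finset.sum_add_distrib]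
  refine congrArg (fun x : ℝ => Complex.exp (Complex.I * Real.pi * (x : ℂ))) ?_
  refine Finset.sum_congr rfl fun j _ => ?_
  rw [← Finset.sum_add_distrib]
  refine Finset.sum_congr rfl fun k _ => ?_
  rw [Pi.add_apply, Int.cast_add]
  ring

/-- The lattice point `(2N + 1) a`. -/
def period (N : ℕ) (a : Fin d → ℤ) : Fin d → ℤ := fun j => (2 * N + 1) * a j

lemma phase_eq_one {F : Matrix (Fin d) (Fin d) ℝ} {n m : Fin d → ℤ} {K : ℤ}
    (h : ∑ j, ∑ k, (n j : ℝ) * F j k * (m k : ℝ) = 2 * K) : phase F n m = 1 := by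
  rw [phase, h, Complex.exp_eq_one_iff]
  refine ⟨K, ?_⟩
  push_cast
  ring

variable {F : Matrix (Fin d) (Fin d) ℝ}

/-- Flux quantization: the factor 2N+1 of the period cancels the denominator of `F`, leaving exp(2πi
· integer). -/
lemma phase_period_left (hF : ∀ i j, ∃ k : ℤ, F i j = 2 / (2 * N + 1) * k) (a m : Fin d → ℤ) :
    phase F (period N a) m = 1 := by
  choose k hk using hF
  refine phase_eq_one (K := ∑ i, ∑ j, a i * k i j * m j) ?_
  push_cast
  rw [Finset.mul_sum]
  refine Finset.sum_congr rfl fun i _ => ?_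
  rw [Finset.mul_sum]
  refine Finset.sum_congr rfl fun j _ => ?_
  rw [hk, period]
  push_cast
  field_simp

lemma phase_period_right (hF : ∀ i j, ∃ k : ℤ, F i j = 2 / (2 * N + 1) * k) (n a : Fin d → ℤ) :
    phase F n (period N a) = 1 := by
  choose k hk using hF
  refine phase_eq_one (K := ∑ i, ∑ j, n i * k i j * a j) ?_
  push_cast
  rw [Finset.mul_sum]
  refine Finset.sum_congr rfl fun i _ => ?_
  rw [Finset.mul_sum]
  refine Finset.sum_congr rfl fun j _ => ?_
  rw [hk, period]
  push_cast
  field_simp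

lemma wrap_add (n m : Fin d → ℤ) : (wrap (n + m) : Torus d N) = wrap n + wrap m :=
  funext fun _ => Int.cast_add _ _

lemma wrap_sub (n m : Fin d → ℤ) : (wrap (n - m) : Torus d N) = wrap n - wrap m :=
  funext fun _ => Int.cast_sub _ _

lemma wrap_coord (p : Torus d N) : wrap (coord p) = p :=
  funext fun j => ZMod.coe_valMinAbs (p j)

lemma wrap_period (a : Fin d → ℤ) : (wrap (period N a) : Torus d N) = 0 := by
  funext j
  have : ((2 * N + 1 : ℕ) : ZMod (2 * N + 1)) = 0 := ZMod.natCast_self _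
  simp only [wrap, period, Pi.zero_apply]
  push_cast at this ⊢
  rw [this, zero_mul]

lemma exists_period_of_wrap_eq {n m : Fin d → ℤ} (h : (wrap n : Torus d N) = wrap m) :
    ∃ a, m = n + period N a := by
  have h1 : ∀ j, ((2 * N + 1 : ℕ) : ℤ) ∣ m j - n j := fun j =>
    (ZMod.intCast_eq_intCast_iff_dvd_sub _ _ _).1 (congrFun h j)
  choose a ha using h1
  refine ⟨a, funext fun j => ?_⟩
  have := ha j
  simp only [Pi.add_apply, period]
  push_cast at this
  linarith

lemma phase_congr (hF : ∀ i j, ∃ k : ℤ, F i j = 2 / (2 * N + 1) * k) {n n' m m' : Fin d → ℤ}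
    (hn : (wrap n : Torus d N) = wrap n') (hm : (wrap m : Torus d N) = wrap m') :
    phase F n m = phase F n' m' := by
  obtain ⟨a, rfl⟩ := exists_period_of_wrap_eq hn
  obtain ⟨b, rfl⟩ := exists_period_of_wrap_eq hm
  rw [phase_add_left, phase_period_left hF, mul_one, phase_add_right, phase_period_right hF,
    mul_one]

lemma period_injective : Function.Injective (period N : (Fin d → ℤ) → Fin d → ℤ) := by
  intro a b h
  funext j
  have := congrFun h j
  simp only [period] at this
  exact mul_left_cancel₀ (by positivity) this

lemma period_zero : period N (0 : Fin d → ℤ) = 0 := by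
  funext j
  simp [period]

lemma period_add (a b : Fin d → ℤ) : period N (a + b) = period N a + period N b := by
  funext j
  simp [period, mul_add]

/-- The sum of `g` over the lattice points below the same point of the torus as `m`. -/
noncomputable def periodSum (N : ℕ) (g : (Fin d → ℤ) → ℂ) (m : Fin d → ℤ) : ℂ :=
  ∑' a, g (m + period N a)

lemma periodSum_congr (g : (Fin d → ℤ) → ℂ) {m m' : Fin d → ℤ}
    (h : (wrap m : Torus d N) = wrap m') : periodSum N g m = periodSum N g m' := by
  obtain ⟨b, rfl⟩ := exists_period_of_wrap_eq h
  rw [periodSum, periodSum, ← (Equiv.addLeft b).tsum_eq]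
  refine tsum_congr fun a => ?_
  rw [Equiv.coe_addLeft, period_add, add_assoc]

/-- The matrix of `π̃_ω f`. -/
noncomputable def torusMatrix (F : Matrix (Fin d) (Fin d) ℝ) (f : Torus d N → C(Config d N, ℂ))
    (ω : Config d N) : Matrix (Torus d N) (Torus d N) ℂ :=
  Matrix.of fun p q => f (q - p) (rot (-p) ω) * phase F (coord q) (coord p)

/-- The periodization of the matrix of an operator on `ℓ²(ℤ^d)`. -/
noncomputable def periodize (N : ℕ) (R : L2 d →L[ℂ] L2 d) : Matrix (Torus d N) (Torus d N) ℂ :=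
  Matrix.of fun p q => periodSum N (fun m => R (basisVec m) (coord p)) (coord q)

/-- This is `R * (z - H) = 1` read on matrix entries. Only finitely many hops occur, so it can be
summed over periods term by term. -/
lemma resolvent_hop_identity {f : Torus d N → C(Config d N, ℂ)} {ω : Config d N} {z : ℂ}
    {R : L2 d →L[ℂ] L2 d} (hR : R * (algebraMap ℂ _ z - perRep F (mapJ f) ω) = 1)
    (n m : Fin d → ℤ) :
    z * R (basisVec m) n - ∑ t, hopWeight F f ω t (m - coord t) *
      R (basisVec (m - coord t)) n = if n = m then 1 else 0 := by
  have h := congrArg (fun A : L2 d →L[ℂ] L2 d => A (basisVec m) n) hR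
  have hH : perRep F (mapJ f) ω (basisVec m) =
      ∑ t, hopWeight F f ω t (m - coord t) • basisVec (m - coord t) := by
    rw [perRep_mapJ_apply, sum_apply]
    exact Finset.sum_congr rfl fun t _ => weightedShift_basisVec _ _ _ _ _
  have h1 : R (z • basisVec m - ∑ t, hopWeight F f ω t (m - coord t) • basisVec (m - coord t)) n =
      basisVec m n := by
    rw [← hH]
    exact h
  rw [← basisVec_apply, ← h1, map_sub, map_smul, map_sum, lp.coeFn_sub, Pi.sub_apply,
    lp.coeFn_smul, Pi.smul_apply, lp.coeFn_sum, Finset.sum_apply, smul_eq_mul]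
  congr 1
  refine Finset.sum_congr rfl fun t _ => ?_
  rw [map_smul, lp.coeFn_smul, Pi.smul_apply, smul_eq_mul]

/-- The periodization of the resolvent on the lattice is the resolvent on the torus. -/
theorem periodize_mul_sub_eq_one (hF : ∀ i j, ∃ k : ℤ, F i j = 2 / (2 * N + 1) * k)
    {f : Torus d N → C(Config d N, ℂ)} {ω : Config d N} {z : ℂ} {R : L2 d →L[ℂ] L2 d}
    (hR : R * (algebraMap ℂ _ z - perRep F (mapJ f) ω) = 1)
    (hsum : ∀ n m : Fin d → ℤ, Summable fun a => R (basisVec (m + period N a)) n) :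
    periodize N R * (algebraMap ℂ _ z - torusMatrix F f ω) = 1 := by
  classical
  ext p r
  -- By periodicity of `ω` and `phase_congr`, the amplitudes do not depend on the translate and
  -- factor out of the sum over `a`.
  have hw : ∀ t a, hopWeight F f ω t (coord r + period N a - coord t) =
      f t (rot (-(r - t)) ω) * phase F (coord r) (coord (r - t)) := by
    intro t a
    have e : (wrap (coord r + period N a - coord t) : Torus d N) = r - t := by
      rw [wrap_sub, wrap_add, wrap_period, add_zero, wrap_coord, wrap_coord]
    rw [hopWeight, e, sub_add_cancel]
    congr 1
    refine phase_congr hF ?_ ?_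
    · rw [wrap_add, wrap_period, add_zero]
    · rw [e, wrap_coord]
  -- The resolvent identity is summed over the translates of the second index only, so no
  -- translation covariance of `R` is needed.
  have hs : HasSum (fun a => z * R (basisVec (coord r + period N a)) (coord p) -
      ∑ t, hopWeight F f ω t (coord r + period N a - coord t) *
        R (basisVec (coord r + period N a - coord t)) (coord p))
      (z * periodize N R p r - ∑ t, f t (rot (-(r - t)) ω) * phase F (coord r) (coord (r - t)) *
        periodize N R p (r - t)) := by
    refine ((hsum _ _).hasSum.mul_left z).sub (hasSum_sum fun t _ => ?_)
    have h1 : HasSum (fun a => R (basisVec (coord r - coord t + period N a)) (coord p))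
        (periodize N R p (r - t)) := by
      have : periodize N R p (r - t) =
          periodSum N (fun m => R (basisVec m) (coord p)) (coord r - coord t) :=
        periodSum_congr (fun m => R (basisVec m) (coord p))
          (by rw [wrap_sub, wrap_coord, wrap_coord, wrap_coord])
      rw [this]
      exact (hsum _ _).hasSum
    refine (h1.mul_left (f t (rot (-(r - t)) ω) * phase F (coord r) (coord (r - t)))).congr_fun ?_
    intro a
    rw [hw, add_sub_right_comm]
  -- Distinct representatives are never congruent, so only `a = 0` with `p = r` contributes.
  have hs' : HasSum (fun a => if coord p = coord r + period N a then (1 : ℂ) else 0)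
      (if p = r then 1 else 0) := by
    have : (if p = r then (1 : ℂ) else 0) =
        if coord p = coord r + period N (0 : Fin d → ℤ) then (1 : ℂ) else 0 := by
      simp [period_zero, coord_injective.eq_iff]
    rw [this]
    refine hasSum_single 0 fun a ha => if_neg fun h => ha ?_
    have hpr : p = r := by
      rw [← wrap_coord p, h, wrap_add, wrap_period, add_zero, wrap_coord]
    rw [hpr, left_eq_add, ← period_zero (N := N)] at h
    exact period_injective h
  simp only [resolvent_hop_identity hR] at hs
  rw [Matrix.one_apply, ← hs.unique hs', mul_sub, Matrix.sub_apply, ← Algebra.commutes,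
    ← Algebra.smul_def, Matrix.smul_apply, smul_eq_mul, Matrix.mul_apply]
  congr 1
  rw [← (Equiv.subLeft r).sum_comp]
  refine Finset.sum_congr rfl fun t _ => ?_
  rw [Equiv.subLeft_apply, torusMatrix, Matrix.of_apply, sub_sub_cancel]
  ring

/-! ### Summability of exponentials -/

lemma summable_exp_neg_abs {ξ : ℝ} (hξ : 0 < ξ) :
    Summable fun n : ℤ => Real.exp (-ξ * |(n : ℝ)|) := by
  have h : Summable fun n : ℕ => Real.exp (-ξ * n) := by
    have := summable_geometric_of_lt_one (Real.exp_pos (-ξ)).le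
      (by rw [Real.exp_lt_one_iff]; linarith)
    refine this.congr fun n => ?_
    rw [← Real.exp_nat_mul, mul_comm]
  refine Summable.of_nat_of_neg ?_ ?_ <;> refine h.congr fun n => ?_ <;> simp

lemma summable_exp_neg_l1 {ξ : ℝ} (hξ : 0 < ξ) :
    Summable fun n : Fin d → ℤ => Real.exp (-ξ * l1 n) := by
  classical
  refine summable_of_sum_le (c := (∑' n : ℤ, Real.exp (-ξ * |(n : ℝ)|)) ^ d)
    (fun n => (Real.exp_pos _).le) fun s => ?_
  set I : Fin d → Finset ℤ := fun j => s.image fun n => n j with hI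
  calc ∑ n ∈ s, Real.exp (-ξ * l1 n)
      ≤ ∑ n ∈ Fintype.piFinset I, Real.exp (-ξ * l1 n) := by
        refine Finset.sum_le_sum_of_subset_of_nonneg (fun n hn => ?_)
          fun n _ _ => (Real.exp_pos _).le
        exact Fintype.mem_piFinset.2 fun j => Finset.mem_image_of_mem (fun n => n j) hn
    _ = ∑ n ∈ Fintype.piFinset I,
          ∏ j, Real.exp (-ξ * |(n j : ℝ)|) := by
        refine Finset.sum_congr rfl fun n _ => ?_
        rw [← Real.exp_sum, l1, Finset.mul_sum]
    _ = ∏ j : Fin d, ∑ k ∈ I j, Real.exp (-ξ * |(k : ℝ)|) :=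
        (Finset.prod_univ_sum _ fun _ (k : ℤ) => Real.exp (-ξ * |(k : ℝ)|)).symm
    _ ≤ ∏ _j : Fin d, ∑' n : ℤ, Real.exp (-ξ * |(n : ℝ)|) := by
        refine Finset.prod_le_prod (fun j _ => Finset.sum_nonneg fun _ _ => (Real.exp_pos _).le)
          fun j _ => ?_
        exact (summable_exp_neg_abs hξ).sum_le_tsum _ fun _ _ => (Real.exp_pos _).le
    _ = _ := by simp

lemma abs_coord_le (p : Torus d N) (j : Fin d) : |(coord p j : ℝ)| ≤ N := by
  have h := ZMod.natAbs_valMinAbs_le (p j)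
  have h2 : (2 * N + 1) / 2 = N := by omega
  rw [h2] at h
  have h3 : |coord p j| ≤ (N : ℤ) := by
    rw [Int.abs_eq_natAbs]
    exact_mod_cast h
  exact_mod_cast h3

/-- Where `a j` is nonzero, |c + (2N+1)a| ≥ (2N+1)|a| - N ≥ (N+1)|a|. The lower bound then splits
into `N`, giving the factor exp(-ξN), and `l1 a`, keeping the sum over translates convergent
uniformly in `N`. -/
lemma add_l1_le_l1_add_period (p : Torus d N) {a : Fin d → ℤ} (ha : a ≠ 0) :
    N + l1 a ≤ l1 (coord p + period N a) := by
  have h1 : ∀ j, (N + 1) * |(a j : ℝ)| ≤ |((coord p + period N a) j : ℝ)| := by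
    intro j
    by_cases h0 : a j = 0
    · simp [h0]
    · have hc := abs_coord_le p j
      have ha1 : (1 : ℝ) ≤ |(a j : ℝ)| := by exact_mod_cast Int.one_le_abs h0
      have h2 : (2 * N + 1) * |(a j : ℝ)| ≤ |((coord p + period N a) j : ℝ)| + |(coord p j : ℝ)| := by
        have : (2 * N + 1) * (a j : ℝ) = ((coord p + period N a) j : ℝ) - coord p j := by
          simp [period]
        rw [← abs_of_nonneg (by positivity : (0 : ℝ) ≤ 2 * N + 1), ← abs_mul, this]
        exact abs_sub _ _
      nlinarith
  have h2 : (N + 1) * l1 a ≤ l1 (coord p + period N a) := by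
    rw [l1, l1, Finset.mul_sum]
    exact Finset.sum_le_sum fun j _ => h1 j
  have h3 : 1 ≤ l1 a := by
    obtain ⟨j, hj⟩ := Function.ne_iff.1 ha
    have : (1 : ℝ) ≤ |(a j : ℝ)| := by exact_mod_cast Int.one_le_abs hj
    exact this.trans (Finset.single_le_sum (f := fun j => |(a j : ℝ)|)
      (fun j _ => abs_nonneg _) (Finset.mem_univ j))
  nlinarith [(Nat.cast_nonneg N : (0 : ℝ) ≤ N)]

lemma l1_neg (n : Fin d → ℤ) : l1 (-n) = l1 n := by simp [l1]

lemma l1_le_add (n m : Fin d → ℤ) : l1 n ≤ l1 (n + m) + l1 m := by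
  rw [l1, l1, l1, ← Finset.sum_add_distrib]
  refine Finset.sum_le_sum fun j _ => ?_
  have : (n j : ℝ) = ((n + m) j : ℝ) - m j := by simp
  rw [this]
  exact abs_sub _ _

lemma l1_le_l1_period (a : Fin d → ℤ) : l1 a ≤ l1 (period N a) := by
  refine Finset.sum_le_sum fun j _ => ?_
  simp only [period]
  push_cast
  rw [abs_mul, abs_of_nonneg (by positivity : (0 : ℝ) ≤ 2 * N + 1)]
  exact le_mul_of_one_le_left (abs_nonneg _) (by linarith [(Nat.cast_nonneg N : (0 : ℝ) ≤ N)])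

lemma summable_of_exp_decay {ξ C : ℝ} (hξ : 0 < ξ) {g : (Fin d → ℤ) → ℂ} {n : Fin d → ℤ}
    (hg : ∀ m, ‖g m‖ ≤ C * Real.exp (-ξ * l1 (n - m))) (m : Fin d → ℤ) :
    Summable fun a => g (m + period N a) := by
  have hC : 0 ≤ C := by
    have := (norm_nonneg _).trans (hg n)
    exact nonneg_of_mul_nonneg_left this (Real.exp_pos _)
  refine Summable.of_norm_bounded
    (g := fun a => C * Real.exp (ξ * l1 (m - n)) * Real.exp (-ξ * l1 a))
    ((summable_exp_neg_l1 hξ).mul_left _) fun a => (hg _).trans ?_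
  rw [mul_assoc, ← Real.exp_add]
  refine mul_le_mul_of_nonneg_left (Real.exp_le_exp.2 ?_) hC
  have h1 := l1_le_l1_period (N := N) a
  have h2 := l1_le_add (period N a) (m - n)
  have h3 : l1 (n - (m + period N a)) = l1 (period N a + (m - n)) := by
    rw [← l1_neg]
    congr 1
    abel
  rw [h3]
  nlinarith

/-- The periodization of an exponentially decaying function differs little from the function. -/
lemma norm_periodSum_sub_le {ξ C : ℝ} (hξ : 0 < ξ) {g : (Fin d → ℤ) → ℂ}
    (hg : ∀ m, ‖g m‖ ≤ C * Real.exp (-ξ * l1 m)) (p : Torus d N) :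
    ‖periodSum N g (coord p) - g (coord p)‖ ≤
      C * (∑' a : Fin d → ℤ, Real.exp (-ξ * l1 a)) * Real.exp (-ξ * N) := by
  classical
  have hC : 0 ≤ C := by
    have := (norm_nonneg _).trans (hg 0)
    exact nonneg_of_mul_nonneg_left this (Real.exp_pos _)
  have hs : Summable fun a => g (coord p + period N a) :=
    summable_of_exp_decay (n := 0) hξ (fun m => by rw [zero_sub, l1_neg]; exact hg m) _
  rw [periodSum, hs.tsum_eq_add_tsum_ite 0, period_zero, add_zero, add_sub_cancel_left]
  have hb : Summable fun a : Fin d → ℤ => C * Real.exp (-ξ * N) * Real.exp (-ξ * l1 a) :=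
    (summable_exp_neg_l1 hξ).mul_left _
  refine (tsum_of_norm_bounded hb.hasSum fun a => ?_).trans (le_of_eq ?_)
  · by_cases ha : a = 0
    · rw [if_pos ha, norm_zero]
      positivity
    · rw [if_neg ha]
      refine (hg _).trans ?_
      rw [mul_assoc, ← Real.exp_add]
      refine mul_le_mul_of_nonneg_left (Real.exp_le_exp.2 ?_) hC
      have := add_l1_le_l1_add_period p ha
      nlinarith
  · rw [tsum_mul_left]
    ring

end Periodization

/-! ### Self-adjointness of the Hamiltonians -/

section SelfAdjoint

variable {d N : ℕ} {F : Matrix (Fin d) (Fin d) ℝ}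

lemma star_phase (hF : F.transpose = -F) (n m : Fin d → ℤ) :
    star (phase F n m) = phase F m n := by
  rw [phase, phase, Complex.star_def, ← Complex.exp_conj]
  congr 1
  rw [map_mul, map_mul, Complex.conj_I, Complex.conj_ofReal, Complex.conj_ofReal]
  have h : ∑ j, ∑ k, (m j : ℝ) * F j k * (n k : ℝ) = -∑ j, ∑ k, (n j : ℝ) * F j k * (m k : ℝ) := by
    rw [Finset.sum_comm, ← Finset.sum_neg_distrib]
    refine Finset.sum_congr rfl fun j _ => ?_
    rw [← Finset.sum_neg_distrib]
    refine Finset.sum_congr rfl fun k _ => ?_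
    have : F k j = -F j k := congrFun (congrFun hF j) k
    rw [this]
    ring
  rw [h]
  push_cast
  ring

/-- The circumference 2N+1 is odd, so the set of representatives is symmetric. -/
lemma coord_neg (t : Torus d N) : coord (-t) = -coord t := by
  funext j
  have h := ZMod.valMinAbs_mem_Ioc (t j)
  refine (ZMod.valMinAbs_spec _ _).2 ⟨?_, ?_⟩
  · simp [coord]
  · simp only [coord, Pi.neg_apply, mem_Ioc] at h ⊢
    push_cast at h ⊢
    omega

/-- The condition on a function on the torus which makes its operators self-adjoint. -/
def IsHermitianFun (f : Torus d N → C(Config d N, ℂ)) : Prop :=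
  ∀ t q ω, f (-t) (rot (-(q + t)) ω) = star (f t (rot (-q) ω))

lemma isHermitianFun_ham (W : ℝ) : IsHermitianFun (mapP (hamFun W) : Torus d N → _) := by
  intro t q ω
  by_cases h0 : coord t = 0
  · have ht : t = 0 := coord_injective (by rw [h0, coord_zero])
    subst ht
    simp only [mapP, hamFun, neg_zero, add_zero, coord_zero, ContinuousMap.coe_mk]
    simp
  · simp only [mapP, hamFun, coord_neg, ContinuousMap.coe_mk, neg_eq_zero, h0, if_false, add_zero,
      Pi.neg_apply, neg_sq]
    split_ifs <;> simp

/-- The adjoint of the hop by `t` is the hop by `-t`: antisymmetry of `F` conjugates the phase, and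
the Hermitian condition does the same for the amplitude. -/
lemma isSelfAdjoint_perRep (hF : F.transpose = -F) {f : Torus d N → C(Config d N, ℂ)}
    (hf : IsHermitianFun f) (ω : Config d N) : IsSelfAdjoint (perRep F (mapJ f) ω) := by
  rw [ContinuousLinearMap.isSelfAdjoint_iff_isSymmetric]
  intro φ ψ
  have hw : ∀ t n, hopWeight F f ω (-t) (n + coord t) = star (hopWeight F f ω t n) := by
    intro t n
    rw [hopWeight, hopWeight, star_mul', star_phase hF, coord_neg, add_neg_cancel_right, ← hf,
      wrap_add, wrap_coord]
  have key : ∀ t, inner ℂ (weightedShift (hopWeight F f ω t) ‖f t‖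
      (norm_hopWeight_le F f ω t) (coord t) φ) ψ = inner ℂ φ (weightedShift
      (hopWeight F f ω (-t)) ‖f (-t)‖ (norm_hopWeight_le F f ω (-t)) (coord (-t)) ψ) := by
    intro t
    rw [lp.inner_eq_tsum, lp.inner_eq_tsum, ← (Equiv.addRight (coord t)).tsum_eq
      (fun n => inner ℂ (φ n) ((weightedShift (hopWeight F f ω (-t)) ‖f (-t)‖
        (norm_hopWeight_le F f ω (-t)) (coord (-t)) ψ) n))]
    refine tsum_congr fun n => ?_
    rw [Equiv.coe_addRight, weightedShift_apply, weightedShift_apply, hw, coord_neg,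
      add_neg_cancel_right, RCLike.inner_apply, RCLike.inner_apply, map_mul]
    simp only [starRingEnd_apply]
    ring
  rw [perRep_mapJ_apply]
  change inner ℂ ((∑ t, weightedShift (hopWeight F f ω t) ‖f t‖
      (norm_hopWeight_le F f ω t) (coord t)) φ) ψ = inner ℂ φ ((∑ t, weightedShift
      (hopWeight F f ω t) ‖f t‖ (norm_hopWeight_le F f ω t) (coord t)) ψ)
  rw [sum_apply, sum_apply, sum_inner, inner_sum,
    ← Equiv.sum_comp (Equiv.neg (Torus d N))]
  exact Finset.sum_congr rfl fun t _ => by rw [← neg_neg t, key]; simp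

lemma torusRep_apply (f : Torus d N → C(Config d N, ℂ)) (ω : Config d N) :
    torusRep F f ω = Matrix.toEuclideanCLM (n := Torus d N) (𝕜 := ℂ) (torusMatrix F f ω) := rfl

lemma isSelfAdjoint_torusRep (hF : F.transpose = -F) {f : Torus d N → C(Config d N, ℂ)}
    (hf : IsHermitianFun f) (ω : Config d N) : IsSelfAdjoint (torusRep F f ω) := by
  rw [torusRep_apply]
  refine IsSelfAdjoint.map ?_ _
  ext p q
  rw [Matrix.star_apply, torusMatrix, Matrix.of_apply, Matrix.of_apply, star_mul', star_phase hF,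
    ← hf, neg_sub, add_sub_cancel]

lemma isSelfAdjoint_perHam (hF : F.transpose = -F) (W : ℝ) :
    IsSelfAdjoint (perHam F W : PerAlg d N F) :=
  Subtype.ext (ContinuousMap.ext fun ω => isSelfAdjoint_perRep hF (isHermitianFun_ham W) ω)

lemma isSelfAdjoint_torusHam (hF : F.transpose = -F) (W : ℝ) :
    IsSelfAdjoint (torusHam F W : TorusAlg d N F) :=
  Subtype.ext (ContinuousMap.ext fun ω => isSelfAdjoint_torusRep hF (isHermitianFun_ham W) ω)

end SelfAdjoint

/-! ### The two algebras -/

section Algebras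

variable {d N : ℕ} {F : Matrix (Fin d) (Fin d) ℝ}

/-- The representation of the periodic algebra at `ω`. -/
noncomputable def perEval (ω : Config d N) : PerAlg d N F →ₐ[ℂ] (L2 d →L[ℂ] L2 d) where
  toFun a := a.1 ω
  map_one' := rfl
  map_mul' _ _ := rfl
  map_zero' := rfl
  map_add' _ _ := rfl
  commutes' _ := rfl

/-- The representation of the algebra over the torus at `ω`. -/
noncomputable def torusEval (ω : Config d N) : TorusAlg d N F →ₐ[ℂ]
    (EuclideanSpace ℂ (Torus d N) →L[ℂ] EuclideanSpace ℂ (Torus d N)) where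
  toFun a := a.1 ω
  map_one' := rfl
  map_mul' _ _ := rfl
  map_zero' := rfl
  map_add' _ _ := rfl
  commutes' _ := rfl

lemma norm_perEval_le (ω : Config d N) (a : PerAlg d N F) : ‖perEval ω a‖ ≤ ‖a‖ :=
  ContinuousMap.norm_coe_le_norm a.1 ω

lemma norm_torusEval_le (ω : Config d N) (a : TorusAlg d N F) : ‖torusEval ω a‖ ≤ ‖a‖ :=
  ContinuousMap.norm_coe_le_norm a.1 ω

lemma perEval_perHam (ω : Config d N) (W : ℝ) :
    perEval ω (perHam F W : PerAlg d N F) = perRep F (mapJ (mapP (hamFun W))) ω := rfl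

lemma torusEval_torusHam (ω : Config d N) (W : ℝ) :
    torusEval ω (torusHam F W : TorusAlg d N F) = torusRep F (mapP (hamFun W)) ω := rfl

/-- The matrix elements of the periodic algebra as continuous functionals. -/
noncomputable def perFunctional (ω : Config d N) (n : Fin d → ℤ) : PerAlg d N F →L[ℂ] ℂ :=
  LinearMap.mkContinuous
    { toFun := fun a => perEval ω a (basisVec n) 0
      map_add' := fun a b => by rw [map_add]; rfl
      map_smul' := fun c a => by rw [map_smul]; rfl } 1
    (fun a => by
      rw [one_mul]
      refine (lp.norm_apply_le_norm two_ne_zero _ _).trans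
        ((ContinuousLinearMap.le_opNorm _ _).trans ?_)
      rw [norm_basisVec, mul_one]
      exact norm_perEval_le ω a)

/-- The matrix elements of the algebra over the torus as continuous functionals. -/
noncomputable def torusFunctional (ω : Config d N) (p : Torus d N) : TorusAlg d N F →L[ℂ] ℂ :=
  LinearMap.mkContinuous
    { toFun := fun a => (torusEval ω a (EuclideanSpace.single p 1)).ofLp 0
      map_add' := fun a b => by rw [map_add]; rfl
      map_smul' := fun c a => by rw [map_smul]; rfl } 1
    (fun a => by
      rw [one_mul]
      refine (PiLp.norm_apply_le _ _).trans ((ContinuousLinearMap.le_opNorm _ _).trans ?_)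
      rw [PiLp.norm_single, norm_one, mul_one]
      exact norm_torusEval_le ω a)

lemma perKernel_apply (a : PerAlg d N F) (n : Fin d → ℤ) (ω : Config d N) :
    perKernel a n ω = perFunctional ω n a := by
  have := lp.inner_single_left (𝕜 := ℂ) (0 : Fin d → ℤ) (1 : ℂ) (perEval ω a (basisVec n))
  refine Eq.trans this ?_
  rw [RCLike.inner_apply, map_one, mul_one]
  rfl

lemma torusKernel_apply (a : TorusAlg d N F) (p : Torus d N) (ω : Config d N) :
    torusKernel a p ω = torusFunctional ω p a := rfl

/-- Nontriviality makes the spectrum nonempty, without which `infDist` would take its default value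
0. -/
instance nontrivial_perAlg : Nontrivial (PerAlg d N F) := by
  refine ⟨⟨0, 1, fun h => ?_⟩⟩
  have ω : Config d N := fun _ => ⟨0, by norm_num⟩
  have h1 := congrArg (fun a => perFunctional ω 0 a) h
  rw [map_zero] at h1
  have h2 : perFunctional ω 0 (1 : PerAlg d N F) = 1 := by
    change perEval ω (1 : PerAlg d N F) (basisVec 0) 0 = 1
    rw [map_one, one_apply_eq_self, basisVec_apply, if_pos rfl]
  exact zero_ne_one (h1.trans h2)

/-- A sufficient condition for being outside of the spectrum of a torus Hamiltonian. -/
lemma notMem_spectrum_torusHam {W : ℝ} {z : ℂ}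
    (h : ∀ ω, ∃ B : Matrix (Torus d N) (Torus d N) ℂ,
      B * (algebraMap ℂ _ z - torusMatrix F (mapP (hamFun W)) ω) = 1) :
    z ∉ spectrum ℂ (torusHam F W : TorusAlg d N F) := by
  have hcl := isClosed_generatedAlg (A := TorusOps d N) (Set.range (torusRep F))
  -- By spectral permanence, invertibility may be tested in the ambient algebra of continuous
  -- families, where it is pointwise in `ω`. For finite matrices a one-sided inverse is enough.
  have e : spectrum ℂ (torusHam F W : TorusAlg d N F) =
      spectrum ℂ (torusRep F (mapP (hamFun W)) : TorusOps d N) :=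
    StarSubalgebra.spectrum_eq (S := generatedAlg (A := TorusOps d N) (Set.range (torusRep F)))
      (hS := hcl) (a := torusHam F W)
  rw [e, spectrum.notMem_iff, ContinuousMap.isUnit_iff_forall_isUnit]
  intro ω
  obtain ⟨B, hB⟩ := h ω
  have hu : IsUnit (algebraMap ℂ _ z - torusMatrix F (mapP (hamFun W)) ω) :=
    ⟨⟨_, B, mul_eq_one_comm.1 hB, hB⟩, rfl⟩
  have := hu.map (Matrix.toEuclideanCLM (n := Torus d N) (𝕜 := ℂ))
  rw [map_sub, AlgHomClass.commutes] at this
  exact this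

end Algebras

/-! ### Functional calculus on a set containing the spectrum -/

section FunctionalCalculus

variable {A : Type*} [CStarAlgebra A] {S : Set ℂ}

/-- The functional calculus of `a` on the continuous functions on a set containing its
spectrum. -/
noncomputable def calculusOn {a : A} (ha : IsStarNormal a) (h : spectrum ℂ a ⊆ S) :
    C(S, ℂ) →⋆ₐ[ℂ] A :=
  (cfcHom ha).comp (ContinuousMap.compStarAlgHom' ℂ ℂ
    ⟨Set.inclusion h, continuous_inclusion h⟩)

lemma calculusOn_apply {a : A} (ha : IsStarNormal a) (h : spectrum ℂ a ⊆ S) (φ : C(S, ℂ)) :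
    calculusOn ha h φ = cfcHom ha (φ.comp ⟨Set.inclusion h, continuous_inclusion h⟩) := rfl

lemma continuous_calculusOn {a : A} (ha : IsStarNormal a) (h : spectrum ℂ a ⊆ S) :
    Continuous (calculusOn ha h) :=
  (cfcHom_continuous ha).comp (ContinuousMap.continuous_precomp _)

/-- The functional calculus on `S` as a continuous linear map. -/
noncomputable def calculusOnCLM {a : A} (ha : IsStarNormal a) (h : spectrum ℂ a ⊆ S) :
    C(S, ℂ) →L[ℂ] A :=
  ⟨(calculusOn ha h : C(S, ℂ) →ₗ[ℂ] A), continuous_calculusOn ha h⟩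

/-- The lattice and torus Hamiltonians have different spectra; this presents both functional calculi
on the same space C(S, ℂ), where they can be compared. -/
lemma cfc_eq_calculusOn {a : A} (ha : IsStarNormal a) (h : spectrum ℂ a ⊆ S) {Φ : ℂ → ℂ}
    (hΦ : ContinuousOn Φ S) {φ : C(S, ℂ)} (hφ : ∀ s : S, φ s = Φ s) :
    cfc Φ a = calculusOn ha h φ := by
  rw [cfc_apply Φ a ha (hΦ.mono h), calculusOn_apply]
  congr 1
  ext s
  exact (hφ ⟨s, h s.2⟩).symm

lemma calculusOn_resolventFun {a : A} (ha : IsStarNormal a) (h : spectrum ℂ a ⊆ S) {z : ℂ}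
    (hz : z ∉ S) :
    calculusOn ha h (resolventFun S z) * (algebraMap ℂ A z - a) = 1 ∧
      (algebraMap ℂ A z - a) * calculusOn ha h (resolventFun S z) = 1 := by
  have hid : calculusOn ha h (algebraMap ℂ C(S, ℂ) z - ⟨Subtype.val, continuous_subtype_val⟩) =
      algebraMap ℂ A z - a := by
    rw [map_sub, AlgHomClass.commutes]
    congr 1
    exact cfcHom_id ha
  rw [← hid, ← map_mul, ← map_mul, resolventFun, Ring.inverse_mul_cancel _ (isUnit_sub_coe hz),
    Ring.mul_inverse_cancel _ (isUnit_sub_coe hz), map_one]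
  exact ⟨rfl, rfl⟩

lemma norm_calculusOn_resolventFun_le {a : A} (ha : IsStarNormal a) {κ : ℝ} (hκ : 0 < κ)
    {z : ℂ} (hz : infDist z (spectrum ℂ a) = κ) :
    ‖calculusOn ha subset_rfl (resolventFun (spectrum ℂ a) z)‖ ≤ κ⁻¹ := by
  have hzS : z ∉ spectrum ℂ a := fun h => hκ.ne (by rw [← hz, infDist_zero_of_mem h])
  rw [calculusOn_apply, norm_cfcHom a _ ha, ContinuousMap.norm_le _ (by positivity)]
  intro s
  have e : resolventFun (spectrum ℂ a) z (Set.inclusion subset_rfl s) = (z - (s : ℂ))⁻¹ :=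
    resolventFun_apply hzS _
  refine (congrArg norm e).trans_le ?_
  rw [norm_inv]
  refine inv_anti₀ hκ ?_
  rw [← hz, ← dist_eq_norm]
  exact infDist_le_dist_of_mem s.2

end FunctionalCalculus

/-! ### Comparison of the torus and lattice kernels. -/

section Comparison

variable {d N : ℕ} {F : Matrix (Fin d) (Fin d) ℝ}

lemma exists_decay_rate (hd : 0 < d) {κ : ℝ} (hκ : 0 < κ) :
    ∃ ξ : ℝ, 0 < ξ ∧ 2 * d * Real.sinh ξ < κ := by
  have hd' : (0 : ℝ) < d := by exact_mod_cast hd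
  -- Half the threshold argument, so that 2d sinh ξ = κ/2.
  refine ⟨Real.arsinh (κ / (4 * d)), Real.arsinh_pos_iff.2 (by positivity), ?_⟩
  rw [Real.sinh_arsinh, mul_div_assoc', div_lt_iff₀ (by positivity)]
  nlinarith [mul_pos hκ hd']

/-- The resolvent of the periodic Hamiltonian, evaluated at a configuration. -/
noncomputable def perResolvent (hF : F.transpose = -F) (W : ℝ) (z : ℂ) (ω : Config d N) :
    L2 d →L[ℂ] L2 d :=
  perEval ω (calculusOn (isSelfAdjoint_perHam hF W).isStarNormal subset_rfl
    (resolventFun (spectrum ℂ (perHam F W : PerAlg d N F)) z))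

lemma perResolvent_mul (hF : F.transpose = -F) (W : ℝ) {z : ℂ}
    (hz : z ∉ spectrum ℂ (perHam F W : PerAlg d N F)) (ω : Config d N) :
    perResolvent hF W z ω * (algebraMap ℂ _ z - perRep F (mapJ (mapP (hamFun W))) ω) = 1 ∧
      (algebraMap ℂ _ z - perRep F (mapJ (mapP (hamFun W))) ω) * perResolvent hF W z ω = 1 := by
  obtain ⟨h1, h2⟩ := calculusOn_resolventFun (isSelfAdjoint_perHam hF W).isStarNormal
    subset_rfl hz
  rw [← perEval_perHam, perResolvent, ← AlgHom.commutes (perEval ω) z, ← map_sub, ← map_mul,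
    ← map_mul, h1, h2, map_one]
  exact ⟨rfl, rfl⟩

lemma norm_perResolvent_apply_le (hF : F.transpose = -F) (W : ℝ) {ξ κ : ℝ} (hξ : 0 ≤ ξ)
    (hκ : 0 < κ) (hξκ : 2 * d * Real.sinh ξ < κ) {z : ℂ}
    (hz : infDist z (spectrum ℂ (perHam F W : PerAlg d N F)) = κ) (ω : Config d N)
    (n m : Fin d → ℤ) :
    ‖perResolvent hF W z ω (basisVec m) n‖ ≤
      (κ - 2 * d * Real.sinh ξ)⁻¹ * Real.exp (-ξ * l1 (n - m)) := by
  have hzS : z ∉ spectrum ℂ (perHam F W : PerAlg d N F) := fun h =>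
    hκ.ne (by rw [← hz, infDist_zero_of_mem h])
  obtain ⟨h1, h2⟩ := perResolvent_mul hF W hzS ω
  exact norm_resolvent_apply_le hξ hκ hξκ h1 h2 ((norm_perEval_le ω _).trans
    (norm_calculusOn_resolventFun_le _ hκ hz)) n m

lemma periodize_perResolvent_mul (hd : 0 < d) (hF : F.transpose = -F)
    (hF' : ∀ i j, ∃ k : ℤ, F i j = 2 / (2 * N + 1) * k) (W : ℝ) {z : ℂ}
    (hz : z ∉ spectrum ℂ (perHam F W : PerAlg d N F)) (ω : Config d N) :
    periodize N (perResolvent hF W z ω) *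
      (algebraMap ℂ _ z - torusMatrix F (mapP (hamFun W)) ω) = 1 := by
  have hne : (spectrum ℂ (perHam F W : PerAlg d N F)).Nonempty := spectrum.nonempty _
  have hpos : 0 < infDist z (spectrum ℂ (perHam F W : PerAlg d N F)) :=
    ((spectrum.isClosed _).notMem_iff_infDist_pos hne).1 hz
  -- Here `z` is any point off the spectrum, possibly very near it. Summability needs only some
  -- positive rate, so the rate is adapted to the distance of `z`.
  obtain ⟨ξ, hξ, hξκ⟩ := exists_decay_rate hd hpos
  refine periodize_mul_sub_eq_one hF' (perResolvent_mul hF W hz ω).1 fun n m => ?_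
  exact summable_of_exp_decay (g := fun m => perResolvent hF W z ω (basisVec m) n) hξ
    (fun m => norm_perResolvent_apply_le hF W hξ.le hpos hξκ rfl ω n m) m

/-- The spectrum on the torus lies in the spectrum of the periodic Hamiltonian. -/
lemma spectrum_torusHam_subset (hd : 0 < d) (hF : F.transpose = -F)
    (hF' : ∀ i j, ∃ k : ℤ, F i j = 2 / (2 * N + 1) * k) (W : ℝ) :
    spectrum ℂ (torusHam F W : TorusAlg d N F) ⊆ spectrum ℂ (perHam F W : PerAlg d N F) := by
  intro z hz
  by_contra hzS
  exact notMem_spectrum_torusHam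
    (fun ω => ⟨_, periodize_perResolvent_mul hd hF hF' W hzS ω⟩) hz

/-- The functional calculus gives a right inverse of z - h̃ and periodization a left inverse, so the
two agree. -/
lemma torusFunctional_resolvent (hd : 0 < d) (hF : F.transpose = -F)
    (hF' : ∀ i j, ∃ k : ℤ, F i j = 2 / (2 * N + 1) * k) (W : ℝ) {z : ℂ}
    (hz : z ∉ spectrum ℂ (perHam F W : PerAlg d N F)) (ω : Config d N) (p : Torus d N) :
    torusFunctional ω p (calculusOn (isSelfAdjoint_torusHam hF W).isStarNormal
      (spectrum_torusHam_subset hd hF hF' W)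
      (resolventFun (spectrum ℂ (perHam F W : PerAlg d N F)) z)) =
    periodSum N (fun m => perResolvent hF W z ω (basisVec m) 0) (coord p) := by
  obtain ⟨-, h2⟩ := calculusOn_resolventFun (isSelfAdjoint_torusHam hF W).isStarNormal
    (spectrum_torusHam_subset hd hF hF' W) hz
  set Rt := calculusOn (isSelfAdjoint_torusHam hF W).isStarNormal
      (spectrum_torusHam_subset hd hF hF' W)
      (resolventFun (spectrum ℂ (perHam F W : PerAlg d N F)) z) with hRt
  have h3 := congrArg (torusEval ω) h2
  rw [map_mul, map_sub, map_one, AlgHom.commutes, torusEval_torusHam, torusRep_apply] at h3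
  have h4 := congrArg (Matrix.toEuclideanCLM (n := Torus d N) (𝕜 := ℂ))
    (periodize_perResolvent_mul hd hF hF' W hz ω)
  rw [map_mul, map_sub, map_one, AlgHomClass.commutes] at h4
  have h5 := left_inv_eq_right_inv h4 h3
  change (torusEval ω Rt (EuclideanSpace.single p 1)).ofLp 0 = _
  rw [← h5, Matrix.ofLp_toEuclideanCLM]
  simp only [PiLp.ofLp_single, Matrix.mulVec_single_one, Matrix.col_apply]
  rw [periodize, Matrix.of_apply, coord_zero]

variable {κ ξ W : ℝ} {Φ : ℂ → ℂ}

/-- Exponential decay of the kernel of `Φ(J h̃)`. -/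
lemma norm_perKernel_cfc_le (hF : F.transpose = -F) (hκ : 0 < κ) (hξ : 0 < ξ)
    (hξκ : 2 * d * Real.sinh ξ < κ)
    (hΦ : AnalyticOnNhd ℂ Φ {z | infDist z (spectrum ℂ (perHam F W : PerAlg d N F)) ≤ κ})
    (n : Fin d → ℤ) (ω : Config d N) :
    ‖perKernel (cfc Φ (perHam F W : PerAlg d N F)) n ω‖ ≤
      (κ - 2 * d * Real.sinh ξ)⁻¹ * Real.exp (-ξ * l1 n) *
        contourMean (spectrum ℂ (perHam F W : PerAlg d N F)) κ Φ := by
  have hne : (spectrum ℂ (perHam F W : PerAlg d N F)).Nonempty := spectrum.nonempty _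
  have hsa := isSelfAdjoint_perHam (N := N) hF W
  have hre : ∀ z ∈ spectrum ℂ (perHam F W : PerAlg d N F), z.im = 0 := fun z hz =>
    hsa.im_eq_zero_of_mem_spectrum hz
  have hΦc : ContinuousOn Φ (spectrum ℂ (perHam F W : PerAlg d N F)) := fun s hs =>
    (hΦ s (show infDist s _ ≤ κ by
      rw [infDist_zero_of_mem hs]; exact hκ.le)).continuousAt.continuousWithinAt
  rw [perKernel_apply, cfc_eq_calculusOn hsa.isStarNormal subset_rfl hΦc
    (φ := ⟨_, hΦc.domRestrict⟩) (fun _ => rfl)]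
  refine norm_apply_le_contourMean hne hre hκ hΦ _ (fun _ => rfl)
    ((perFunctional ω n).comp (calculusOnCLM hsa.isStarNormal subset_rfl)) _ fun z hz => ?_
  have h := norm_perResolvent_apply_le hF W hξ.le hκ hξκ hz ω 0 n
  rw [zero_sub, l1_neg] at h
  exact h

/-- The kernels of `Φ(h̃)` and `Φ(J h̃)` are exponentially close. -/
lemma norm_torusKernel_sub_perKernel_le (hd : 0 < d) (hF : F.transpose = -F)
    (hF' : ∀ i j, ∃ k : ℤ, F i j = 2 / (2 * N + 1) * k) (hκ : 0 < κ) (hξ : 0 < ξ)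
    (hξκ : 2 * d * Real.sinh ξ < κ)
    (hΦ : AnalyticOnNhd ℂ Φ {z | infDist z (spectrum ℂ (perHam F W : PerAlg d N F)) ≤ κ})
    (p : Torus d N) (ω : Config d N) :
    ‖torusKernel (cfc Φ (torusHam F W : TorusAlg d N F)) p ω -
      perKernel (cfc Φ (perHam F W : PerAlg d N F)) (coord p) ω‖ ≤
      (κ - 2 * d * Real.sinh ξ)⁻¹ * (∑' a : Fin d → ℤ, Real.exp (-ξ * l1 a)) *
        Real.exp (-ξ * N) * contourMean (spectrum ℂ (perHam F W : PerAlg d N F)) κ Φ := by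
  have hne : (spectrum ℂ (perHam F W : PerAlg d N F)).Nonempty := spectrum.nonempty _
  have hsa := isSelfAdjoint_perHam (N := N) hF W
  have hsa' := isSelfAdjoint_torusHam (N := N) hF W
  have hre : ∀ z ∈ spectrum ℂ (perHam F W : PerAlg d N F), z.im = 0 := fun z hz =>
    hsa.im_eq_zero_of_mem_spectrum hz
  have hΦc : ContinuousOn Φ (spectrum ℂ (perHam F W : PerAlg d N F)) := fun s hs =>
    (hΦ s (show infDist s _ ≤ κ by
      rw [infDist_zero_of_mem hs]; exact hκ.le)).continuousAt.continuousWithinAt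
  have hsub := spectrum_torusHam_subset hd hF hF' W
  rw [perKernel_apply, torusKernel_apply, cfc_eq_calculusOn hsa.isStarNormal subset_rfl hΦc
    (φ := ⟨_, hΦc.domRestrict⟩) (fun _ => rfl), cfc_eq_calculusOn hsa'.isStarNormal hsub hΦc
    (φ := ⟨_, hΦc.domRestrict⟩) (fun _ => rfl)]
  -- The difference of the torus and lattice matrix elements is a single functional on C(S, ℂ); on a
  -- resolvent it is the periodization error at the origin's row.
  refine norm_apply_le_contourMean hne hre hκ hΦ _ (fun _ => rfl)
    ((torusFunctional ω p).comp (calculusOnCLM hsa'.isStarNormal hsub) -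
      (perFunctional ω (coord p)).comp (calculusOnCLM hsa.isStarNormal subset_rfl)) _
    fun z hz => ?_
  have hzS : z ∉ spectrum ℂ (perHam F W : PerAlg d N F) := fun h =>
    hκ.ne (by rw [← hz, infDist_zero_of_mem h])
  have h := norm_periodSum_sub_le (g := fun m => perResolvent hF W z ω (basisVec m) 0) hξ
    (fun m => by
      have h := norm_perResolvent_apply_le hF W hξ.le hκ hξκ hz ω 0 m
      rwa [zero_sub, l1_neg] at h) p
  rw [← torusFunctional_resolvent hd hF hF' W hzS] at h
  exact h

lemma card_torus (d N : ℕ) : Fintype.card (Torus d N) = (2 * N + 1) ^ d := by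
  rw [Fintype.card_fun, ZMod.card, Fintype.card_fin]

/-- The norm of an element of the algebra over the torus is at most its supremum times the number
of points of the torus. -/
lemma norm_torusElt_le {g : Torus d N → C(Config d N, ℂ)} {c : ℝ} (hc : 0 ≤ c)
    (hg : ∀ p ω, ‖g p ω‖ ≤ c) :
    ‖torusElt F g‖ ≤ (2 * N + 1) ^ d * c := by
  change ‖torusRep F g‖ ≤ _
  rw [ContinuousMap.norm_le _ (by positivity)]
  intro ω
  refine ContinuousLinearMap.opNorm_le_bound _ (by positivity) fun φ => ?_
  have hcard : (Fintype.card (Torus d N) : ℝ) = (2 * N + 1) ^ d := by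
    rw [card_torus]; push_cast; ring
  have hcoord : ∀ p, ‖(torusRep F g ω φ).ofLp p‖ ^ 2 ≤
      (2 * N + 1) ^ d * (c ^ 2 * ‖φ‖ ^ 2) := by
    intro p
    have h1 : ‖(torusRep F g ω φ).ofLp p‖ ≤ ∑ q, c * ‖φ q‖ := by
      rw [torusRep_apply, Matrix.ofLp_toEuclideanCLM, Matrix.mulVec, dotProduct]
      refine (norm_sum_le _ _).trans (Finset.sum_le_sum fun q _ => ?_)
      rw [norm_mul, torusMatrix, Matrix.of_apply, norm_mul, norm_phase, mul_one]
      exact mul_le_mul_of_nonneg_right (hg _ _) (norm_nonneg _)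
    -- Cauchy–Schwarz in each row, followed by the sum over rows: each contributes one factor of the
    -- number of points to the squared norm.
    calc ‖(torusRep F g ω φ).ofLp p‖ ^ 2 ≤ (∑ q, c * ‖φ q‖) ^ 2 :=
          pow_le_pow_left₀ (norm_nonneg _) h1 2
      _ ≤ (Finset.univ : Finset (Torus d N)).card * ∑ q, (c * ‖φ q‖) ^ 2 :=
          sq_sum_le_card_mul_sum_sq
      _ = (2 * N + 1) ^ d * (c ^ 2 * ‖φ‖ ^ 2) := by
          rw [Finset.card_univ, hcard, EuclideanSpace.norm_sq_eq]
          simp only [mul_pow, ← Finset.mul_sum]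
  refine (abs_le_of_sq_le_sq' ?_ (by positivity)).2
  rw [EuclideanSpace.norm_sq_eq]
  refine (Finset.sum_le_sum fun p _ => hcoord p).trans (le_of_eq ?_)
  rw [Finset.sum_const, Finset.card_univ, nsmul_eq_mul, hcard]
  ring

lemma contourMean_nonneg (S : Set ℂ) (κ : ℝ) (Φ : ℂ → ℂ) : 0 ≤ contourMean S κ Φ :=
  mul_nonneg (by positivity) (integral_nonneg fun _ => by positivity)

lemma norm_prod_pow_le {α : Fin d → ℕ} {x : Fin d → ℝ} (hx : ∀ j, |x j| ≤ N) :
    ‖∏ j, (Complex.I * (x j : ℂ)) ^ α j‖ ≤ (N : ℝ) ^ (∑ j, α j) := by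
  rw [norm_prod, ← Finset.prod_pow_eq_pow_sum]
  refine Finset.prod_le_prod (fun j _ => norm_nonneg _) fun j _ => ?_
  rw [norm_pow, norm_mul, Complex.norm_I, one_mul, Complex.norm_real]
  exact pow_le_pow_left₀ (abs_nonneg _) (hx j) _

/-- Splitting as a(u - v) + (a - b)v separates the error of the kernels from that of the symbols.
The second term is absent where the symbols agree, and elsewhere is controlled by ‖a - b‖ ≤ 2P and a
small kernel. -/
lemma norm_smul_sub_smul_le {a b u v : ℂ} {P e f : ℝ} (ha : ‖a‖ ≤ P) (hb : ‖b‖ ≤ P)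
    (he : ‖u - v‖ ≤ e) (hf : a = b ∨ ‖v‖ ≤ f) (hf0 : 0 ≤ f) :
    ‖a * u - b * v‖ ≤ P * (e + 2 * f) := by
  have hP : 0 ≤ P := (norm_nonneg a).trans ha
  have h1 : a * u - b * v = a * (u - v) + (a - b) * v := by ring
  rw [h1, mul_add]
  refine (norm_add_le _ _).trans (add_le_add ?_ ?_)
  · rw [norm_mul]
    exact mul_le_mul ha he (norm_nonneg _) hP
  · rcases hf with h | h
    · rw [h, sub_self, zero_mul, norm_zero]
      positivity
    · rw [norm_mul]
      have : ‖a - b‖ ≤ 2 * P := (norm_sub_le _ _).trans (by linarith)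
      calc ‖a - b‖ * ‖v‖ ≤ 2 * P * f := mul_le_mul this h (norm_nonneg _) (by positivity)
        _ = P * (2 * f) := by ring

/-- The pointwise comparison of the approximate and the exact derivatives. -/
lemma norm_derivT_sub_derivZ_le (hd : 0 < d) (hF : F.transpose = -F)
    (hF' : ∀ i j, ∃ k : ℤ, F i j = 2 / (2 * N + 1) * k) (hκ : 0 < κ) (hξ : 0 < ξ)
    (hξκ : 2 * d * Real.sinh ξ < κ) {𝔵 : ZMod (2 * N + 1) → ℝ}
    (h𝔵 : ∀ p, |(p.valMinAbs : ℝ)| < N / Real.sqrt 2 → 𝔵 p = p.valMinAbs)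
    (h𝔵' : ∀ p, |𝔵 p| ≤ |(p.valMinAbs : ℝ)|)
    (hΦ : AnalyticOnNhd ℂ Φ {z | infDist z (spectrum ℂ (perHam F W : PerAlg d N F)) ≤ κ})
    (α : Fin d → ℕ) (p : Torus d N) (ω : Config d N) :
    ‖(derivT 𝔵 α (torusKernel (cfc Φ (torusHam F W : TorusAlg d N F)))
      - mapP (derivZ α (perKernel (cfc Φ (perHam F W : PerAlg d N F))))) p ω‖ ≤
      (N : ℝ) ^ (∑ j, α j) * ((κ - 2 * d * Real.sinh ξ)⁻¹ *
        ((∑' a : Fin d → ℤ, Real.exp (-ξ * l1 a)) + 2) *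
        contourMean (spectrum ℂ (perHam F W : PerAlg d N F)) κ Φ *
        Real.exp (-(ξ / Real.sqrt 2) * N)) := by
  set C := (κ - 2 * d * Real.sinh ξ)⁻¹ with hC
  have hC0 : 0 ≤ C := inv_nonneg.2 (by linarith)
  set m := contourMean (spectrum ℂ (perHam F W : PerAlg d N F)) κ Φ with hm
  have hm0 : 0 ≤ m := contourMean_nonneg _ _ _
  set τ := ∑' a : Fin d → ℤ, Real.exp (-ξ * l1 a) with ht
  have ht0 : 0 ≤ τ := tsum_nonneg fun a => (Real.exp_pos _).le
  set E := Real.exp (-(ξ / Real.sqrt 2) * N) with hE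
  have hs2 : 1 ≤ Real.sqrt 2 := Real.one_le_sqrt.2 (by norm_num)
  have hs0 : 0 < Real.sqrt 2 := by linarith
  -- The periodization error has the better rate ξN; the loss of √2 comes only from the symbols.
  have hE1 : Real.exp (-ξ * N) ≤ E := by
    refine Real.exp_le_exp.2 (mul_le_mul_of_nonneg_right ?_ (Nat.cast_nonneg N))
    exact neg_le_neg (div_le_self hξ.le hs2)
  have hdiff : ‖torusKernel (cfc Φ (torusHam F W : TorusAlg d N F)) p ω -
      perKernel (cfc Φ (perHam F W : PerAlg d N F)) (coord p) ω‖ ≤ C * τ * E * m := by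
    refine (norm_torusKernel_sub_perKernel_le hd hF hF' hκ hξ hξκ hΦ p ω).trans ?_
    exact mul_le_mul_of_nonneg_right (mul_le_mul_of_nonneg_left hE1 (by positivity)) hm0
  have hker := norm_perKernel_cfc_le hF hκ hξ hξκ hΦ (coord p) ω
  have hcoord := abs_coord_le p
  refine (norm_smul_sub_smul_le
    (a := ∏ j, (Complex.I * (𝔵 (p j) : ℂ)) ^ α j)
    (b := ∏ j, (Complex.I * (coord p j : ℂ)) ^ α j)
    (norm_prod_pow_le fun j => (h𝔵' (p j)).trans (hcoord j)) ?_ hdiff (f := C * E * m) ?_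
    (by positivity)).trans (le_of_eq (by ring))
  · have := norm_prod_pow_le (α := α) hcoord
    simpa only [Complex.ofReal_intCast] using this
  -- Either every coordinate is in the range where the symbols coincide, or one coordinate alone
  -- makes `l1 (coord p)` at least N/√2.
  · by_cases h : ∀ j, |(coord p j : ℝ)| < N / Real.sqrt 2
    · left
      refine Finset.prod_congr rfl fun j _ => ?_
      rw [h𝔵 (p j) (h j), Complex.ofReal_intCast]
      rfl
    · right
      push Not at h
      obtain ⟨j, hj⟩ := h
      refine hker.trans (mul_le_mul_of_nonneg_right (mul_le_mul_of_nonneg_left ?_ hC0) hm0)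
      refine Real.exp_le_exp.2 ?_
      have hl : N / Real.sqrt 2 ≤ l1 (coord p) := hj.trans
        (Finset.single_le_sum (f := fun j => |(coord p j : ℝ)|) (fun j _ => abs_nonneg _)
          (Finset.mem_univ j))
      have := mul_le_mul_of_nonneg_left hl hξ.le
      rw [neg_mul, neg_mul, div_mul_eq_mul_div, ← mul_div_assoc] at *
      exact neg_le_neg this

end Comparison

end NCTorus

/-! ### The norm estimate. -/

theorem mainTheorem7 (d : ℕ) (hd : 0 < d) (κ : ℝ) (hκ : 0 < κ) :
    ∃ B : ℝ → (Fin d → ℕ) → ℝ,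
      ∀ ξ : ℝ, 0 < ξ → ξ < Real.arsinh (κ / (2 * d)) →
      ∀ α : Fin d → ℕ,
      ∀ N : ℕ, 0 < N →
      ∀ F : Matrix (Fin d) (Fin d) ℝ, F.transpose = -F →
        (∀ i j, ∃ k : ℤ, F i j = 2 / (2 * N + 1) * k) →
      ∀ W : ℝ,
      ∀ 𝔵 : ZMod (2 * N + 1) → ℝ,
        (∀ p, |(p.valMinAbs : ℝ)| < N / Real.sqrt 2 → 𝔵 p = p.valMinAbs) →
        (∀ p, |𝔵 p| ≤ |(p.valMinAbs : ℝ)|) →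
      ∀ Φ : ℂ → ℂ,
        AnalyticOnNhd ℂ Φ
          {z | Metric.infDist z (spectrum ℂ (perHam F W : PerAlg d N F)) ≤ κ} →
        ‖torusElt F (derivT 𝔵 α (torusKernel (cfc Φ (torusHam F W : TorusAlg d N F)))
            - mapP (derivZ α (perKernel (cfc Φ (perHam F W : PerAlg d N F)))))‖
          ≤ B ξ α * contourMean (spectrum ℂ (perHam F W : PerAlg d N F)) κ Φ
              * (N : ℝ) ^ ((∑ j, α j) + d) * Real.exp (-(ξ / Real.sqrt 2) * N) := by
  -- The factor 3^d comes from 2N+1 ≤ 3N, the inverse from Combes–Thomas, the series from the sum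
  -- over translates, and the 2 from the disagreement of the symbols. The constant does not depend
  -- on α.
  refine ⟨fun ξ _ => 3 ^ d * ((κ - 2 * d * Real.sinh ξ)⁻¹ *
    ((∑' a : Fin d → ℤ, Real.exp (-ξ * l1 a)) + 2)), ?_⟩
  intro ξ hξ hξκ α N hN F hF hF' W 𝔵 h𝔵 h𝔵' Φ hΦ
  have hd' : (0 : ℝ) < d := by exact_mod_cast hd
  have hs : 2 * d * Real.sinh ξ < κ := by
    have h := Real.sinh_lt_sinh.2 hξκ
    rw [Real.sinh_arsinh, lt_div_iff₀ (by positivity)] at h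
    linarith
  have hC0 : 0 ≤ (κ - 2 * d * Real.sinh ξ)⁻¹ := inv_nonneg.2 (by linarith)
  have ht0 : 0 ≤ ∑' a : Fin d → ℤ, Real.exp (-ξ * l1 a) := tsum_nonneg fun a => (Real.exp_pos _).le
  have hm0 := contourMean_nonneg (spectrum ℂ (perHam F W : PerAlg d N F)) κ Φ
  refine (norm_torusElt_le (by positivity) fun p ω =>
    norm_derivT_sub_derivZ_le hd hF hF' hκ hξ hs h𝔵 h𝔵' hΦ α p ω).trans ?_
  have hN1 : (1 : ℝ) ≤ N := by exact_mod_cast hN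
  have hcard : (2 * (N : ℝ) + 1) ^ d ≤ 3 ^ d * (N : ℝ) ^ d := by
    rw [← mul_pow]
    exact pow_le_pow_left₀ (by positivity) (by linarith) d
  refine (mul_le_mul_of_nonneg_right hcard (by positivity)).trans (le_of_eq ?_)
  rw [pow_add]
  ring
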